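/- For $t\in\mathbb{R}$ let $P_t\subset\mathbb{R}^5$ be the polytope of the points $(r_1,\dots,r_5)$ with all $r_i\ge 0$, $-r_1-r_2+t\,r_3+r_4+r_5=0$ and $r_1+\dots+r_5=1$, and let $$Z(P_t)=\{x\in\mathbb{R}^5 : -x_1^2-x_2^2+t\,x_3^2+x_4^2+x_5^2=0,\ x_1^2+\dots+x_5^2=1\}$$ be the associated intersection of quadrics; a point $x\in Z(P_t)$ is said to come from the point $(x_1^2,\dots,x_5^2)$ of $P_t$. For every $t$, the map $x\mapsto(x_i|x_i|)_i$ is a homeomorphism of $Z(P_t)$ onto the space obtained from $P_t$ by reflections, i.e. the union of the images of $P_t$ under the group generated by the reflections in the coordinate hyperplanes. Let $P_{p4}=P_0$ be the square pyramid. Its only non-simple vertex (vertex lying on more than three of the facets $r_i=0$) is $V=(0,0,1,0,0)$. Let $\check Z(P_{p4})$ be $Z(P_{p4})$ minus the points that come from $V$. For $t\neq 0$ the triangular prism $P'_{p4}=P_t$ is a smoothing of $P_{p4}$ (one for $t>0$, one for $t<0$), and $E\subset P'_{p4}$ is the edge that replaces $V$, given by $r_4=r_5=0$ if $t>0$ and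 by $r_1=r_2=0$ if $t<0$. Proposition. $Z(P_{p4})$ is homeomorphic to the suspension of the torus $\mathbb{S}^1\times\mathbb{S}^1$, by a homeomorphism under which the points that come from $V$ correspond to the two apices, and $\check Z(P_{p4})$ is the smooth part of $Z(P_{p4})$, i.e. the set of points at which the two equations are transverse. For each $t\ne 0$ the points of $Z(P'_{p4})$ that come from $E$ form two disjoint circles, and $\check Z(P_{p4})$ is homeomorphic to $Z(P'_{p4})$ minus these circles, by a homeomorphism that commutes with the coordinate reflections and preserves the sign of each coordinate. The space $\check Z(P_{p4})$ is homeomorphic to $\mathbb{S}^1\times\mathbb{S}^1\times(-1,1)$. Moreover $Z(P_{p4})$, $Z(P'_{p4})$ (for each $t\ne0$) and $\check Z(P_{p4})$ are path-connected, and for all base points (a) $\pi_1(Z(P_{p4}))=1$; (b) $\pi_1(Z(P'_{p4}))\cong\pi_1(\mathbb{S}^2\times\mathbb{S}^1)\cong\mathbb{Z}$; (c) $\pi_1(\check Z(P_{p4}))\cong\mathbb{Z}^2$. -/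

import Mathlib

open Set

noncomputable section

namespace SquarePyramid

/-- The polytope of a tuple `A = (A₁, …, Aₙ)` of vectors of `ℝᵐ`:
the points `r ≥ 0` of `ℝⁿ` with `∑ rᵢ Aᵢ = 0` and `∑ rᵢ = 1`. -/
def polytope {n m : ℕ} (A : Fin n → Fin m → ℝ) : Set (Fin n → ℝ) :=
  {r | (∀ i, 0 ≤ r i) ∧ ∑ i, r i • A i = 0 ∧ ∑ i, r i = 1}

/-- The defining map `x ↦ (∑ xᵢ² Aᵢ, ∑ xᵢ²)` of the intersection of quadrics. -/
def quadricMap {n m : ℕ} (A : Fin n → Fin m → ℝ) (x : Fin n → ℝ) : (Fin m → ℝ) × ℝ :=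
  (∑ i, x i ^ 2 • A i, ∑ i, x i ^ 2)

/-- The intersection `Z` of a tuple `A`: the solutions in `ℝⁿ` of `∑ xᵢ² Aᵢ = 0`, `∑ xᵢ² = 1`. -/
def quadricIntersection {n m : ℕ} (A : Fin n → Fin m → ℝ) : Set (Fin n → ℝ) :=
  {x | quadricMap A x = (0, 1)}

/-- The smooth part of the intersection: the points where the equations are transverse, that is,
where the derivative of the defining map is onto. -/
def smoothPart {n m : ℕ} (A : Fin n → Fin m → ℝ) : Set (Fin n → ℝ) :=
  {x ∈ quadricIntersection A | Function.Surjective (fderiv ℝ (quadricMap A) x)}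

/-- The points of the intersection that come from a subset `S` of the polytope: `Z` is made of
mirror copies of the polytope, which are identified with it by `x ↦ (x₁², …, xₙ²)`. -/
def pointsOver {n m : ℕ} (A : Fin n → Fin m → ℝ) (S : Set (Fin n → ℝ)) : Set (Fin n → ℝ) :=
  {x ∈ quadricIntersection A | (fun i => x i ^ 2) ∈ S}

/-- The composition of coordinate reflections of `ℝⁿ` with signs `ε`. -/
def reflect {n : ℕ} (ε : Fin n → ℤˣ) (x : Fin n → ℝ) : Fin n → ℝ :=
  fun i => ((ε i : ℤ) : ℝ) * x i

/-- The union of the images of `S ⊆ ℝⁿ` under the group generated by the reflections in the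
coordinate hyperplanes. -/
def reflections {n : ℕ} (S : Set (Fin n → ℝ)) : Set (Fin n → ℝ) :=
  ⋃ ε : Fin n → ℤˣ, reflect ε '' S

/-- The tuple `A_t = (-1, -1, t, 1, 1)` of vectors of `ℝ¹`. -/
def tuple (t : ℝ) : Fin 5 → Fin 1 → ℝ := ![![-1], ![-1], ![t], ![1], ![1]]

/-- The square pyramid `P_{p4}`. -/
def pyramid : Set (Fin 5 → ℝ) := polytope (tuple 0)

/-- The space `Z(P_{p4})`. -/
def pyramidSpace : Set (Fin 5 → ℝ) := quadricIntersection (tuple 0)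

/-- The apex `V = (0, 0, 1, 0, 0)` of the square pyramid. -/
def apex : Fin 5 → ℝ := ![0, 0, 1, 0, 0]

/-- The space `Ž(P_{p4})`: `Z(P_{p4})` minus the points coming from the apex `V`. -/
def puncturedPyramidSpace : Set (Fin 5 → ℝ) := pyramidSpace \ pointsOver (tuple 0) {apex}

/-- For `t ≠ 0`, the smoothing `P'_{p4}` of the pyramid (a triangular prism); the two smoothings
are given by `t > 0` and `t < 0`. -/
def prism (t : ℝ) : Set (Fin 5 → ℝ) := polytope (tuple t)

/-- For `t ≠ 0`, the space `Z(P'_{p4})`. -/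
def prismSpace (t : ℝ) : Set (Fin 5 → ℝ) := quadricIntersection (tuple t)

/-- For `t ≠ 0`, the edge `E` that replaces the apex. The four facets of the pyramid through the
apex form two pairs of opposite facets, `r₁ = 0`, `r₂ = 0` and `r₄ = 0`, `r₅ = 0`. In the prism
exactly one of these pairs still meets, the second one if `t > 0` and the first one if `t < 0`,
and it meets along `E`. -/
def newEdge (t : ℝ) : Set (Fin 5 → ℝ) :=
  {r ∈ prism t | (r 0 = 0 ∧ r 1 = 0) ∨ (r 3 = 0 ∧ r 4 = 0)}

/-- For `t ≠ 0`, the space `Z(P'_{p4})` minus the circles coming from the edge `E`. -/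
def drilledPrismSpace (t : ℝ) : Set (Fin 5 → ℝ) := prismSpace t \ pointsOver (tuple t) (newEdge t)

/-- The relation on `X × [-1, 1]` that collapses `X × {-1}` to a point and `X × {1}` to a point. -/
def suspensionSetoid (X : Type*) : Setoid (X × Icc (-1 : ℝ) 1) where
  r p q := p = q ∨ (p.2 = q.2 ∧ ((p.2 : ℝ) = -1 ∨ (p.2 : ℝ) = 1))
  iseqv :=
    { refl := fun _ => Or.inl rfl
      symm := by
        rintro p q (h | ⟨h, h'⟩)
        · exact Or.inl h.symm
        · exact Or.inr ⟨h.symm, h ▸ h'⟩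
      trans := by
        rintro p q s (rfl | ⟨h, h'⟩) (rfl | ⟨k, k'⟩)
        · exact Or.inl rfl
        · exact Or.inr ⟨k, k'⟩
        · exact Or.inr ⟨h, h'⟩
        · exact Or.inr ⟨h.trans k, h'⟩ }

/-- The (unreduced) suspension, with the quotient topology. -/
abbrev Suspension (X : Type*) [TopologicalSpace X] : Type _ := Quotient (suspensionSetoid X)

/-- The two apices of a suspension. -/
def suspensionApices (X : Type*) [TopologicalSpace X] : Set (Suspension X) :=
  {p | ∃ (x : X) (s : Icc (-1 : ℝ) 1), ((s : ℝ) = -1 ∨ (s : ℝ) = 1) ∧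
    p = Quotient.mk (suspensionSetoid X) (x, s)}

end SquarePyramid

end

noncomputable section

namespace SquarePyramid

/-! Group the coordinates into the blocks `(x 0, x 1)`, `(x 3, x 4)` and the single coordinate `x
2`. For `t = 0` the equations say that both blocks have squared length `(1 - x 2 ^ 2) / 2`. Over
each value of `x 2` in `(-1, 1)` there is thus a product of two circles of the same radius, which
shrinks to a point at `x 2 = ±1`. This is the suspension of the torus, with the points over the apex
as its tips; without them it is the torus times an interval, whose group is `ℤ²`.

For `t ≠ 0` the squared lengths of the blocks differ by `t * x 2 ^ 2`, and the shorter block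
vanishes exactly over the new edge. Away from the edge, positive rescalings of the two blocks and of
`x 2` turn the prism equations into those of the pyramid (`drillHomeomorph`). The longer block never
vanishes, so its direction is a circle factor; the other three coordinates run over an ellipsoid,
which gives `S² × S¹` (`prismHomeomorph`).

Both `Z(P_{p4})` and `S²` are simply connected by one argument (`simplyConnectedSpace_of_cone`).
Each is a section of a cone invariant under translation along a vector `e`. Removing `e` or `-e`
leaves a contractible open set, and the two sets meet in a path-connected set, so van Kampen's
theorem applies in its simplest form (`simplyConnectedSpace_of_union`). -/

/-! ### Fundamental groups: products, the circle, unions of two open sets -/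

open CategoryTheory in
/-- A homotopy equivalence induces an isomorphism of fundamental groups. -/
theorem nonempty_fundamentalGroup_mulEquiv {X Y : Type*} [TopologicalSpace X] [TopologicalSpace Y]
    (e : ContinuousMap.HomotopyEquiv X Y) (x : X) :
    Nonempty (FundamentalGroup X x ≃* FundamentalGroup Y (e x)) := by
  let F := FundamentalGroupoidFunctor.equivOfHomotopyEquiv e
  exact ⟨F.fullyFaithfulFunctor.mulEquivEnd (FundamentalGroupoid.mk x)⟩

/-- The fundamental group of a product. -/
def fundamentalGroupProd {X Y : Type*} [TopologicalSpace X] [TopologicalSpace Y]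
    (x : X) (y : Y) :
    FundamentalGroup (X × Y) (x, y) ≃* FundamentalGroup X x × FundamentalGroup Y y where
  toFun p := (Path.Homotopic.projLeft p, Path.Homotopic.projRight p)
  invFun q := Path.Homotopic.prod q.1 q.2
  left_inv p := Path.Homotopic.prod_projLeft_projRight p
  right_inv q := Prod.ext (Path.Homotopic.projLeft_prod _ _) (Path.Homotopic.projRight_prod _ _)
  map_mul' p q := by
    refine Prod.ext ?_ ?_
    · exact map_mul (FundamentalGroup.map (⟨_, continuous_fst⟩ : C(X × Y, X)) (x, y)) p q
    · exact map_mul (FundamentalGroup.map (⟨_, continuous_snd⟩ : C(X × Y, Y)) (x, y)) p q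

instance : PathConnectedSpace Circle :=
  Circle.isAddQuotientCoveringMap_exp.surjective.pathConnectedSpace Circle.exp.continuous

/-- The exponential is a quotient covering of the circle by the simply connected line, so the
fundamental group is the group `2πℤ` of periods. -/
theorem nonempty_fundamentalGroup_circle (x : Circle) :
    Nonempty (FundamentalGroup Circle x ≃* Multiplicative ℤ) := by
  obtain ⟨r, hr⟩ := Circle.isAddQuotientCoveringMap_exp.surjective x
  have e₁ := Circle.isAddQuotientCoveringMap_exp.fundamentalGroupEquiv (x := x) ⟨r, hr⟩
  let f : ℤ →+ AddSubgroup.zmultiples (2 * Real.pi) :=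
    (zmultiplesHom ℝ (2 * Real.pi)).codRestrict _ fun n => ⟨n, rfl⟩
  have hf : Function.Bijective f := by
    refine ⟨fun m n h => ?_, fun ⟨_, n, hn⟩ => ⟨n, Subtype.ext hn⟩⟩
    have h' : m • (2 * Real.pi) = n • (2 * Real.pi) := congrArg Subtype.val h
    simpa [Real.pi_ne_zero] using h'
  -- The covering yields the opposite of the group of periods, which is harmless because that group
  -- is commutative.
  exact ⟨(e₁.trans MulOpposite.opMulEquiv.symm).trans
    (AddEquiv.ofBijective f hf).symm.toMultiplicative⟩

theorem homotopic_of_range_subset {X : Type*} [TopologicalSpace X] {U : Set X}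
    (hU : IsSimplyConnected U) {p q : X} (γ γ' : Path p q) (h : ∀ s, γ s ∈ U) (h' : ∀ s, γ' s ∈ U) :
    γ.Homotopic γ' := by
  have := hU.simplyConnectedSpace
  have hp : p ∈ U := by simpa using h 0
  have hq : q ∈ U := by simpa using h 1
  let lift (δ : Path p q) (hδ : ∀ s, δ s ∈ U) : Path (⟨p, hp⟩ : U) ⟨q, hq⟩ :=
    { toFun := fun s => ⟨δ s, hδ s⟩
      source' := by simp
      target' := by simp }
  exact (SimplyConnectedSpace.paths_homotopic (lift γ h) (lift γ' h')).map
    ⟨Subtype.val, continuous_subtype_val⟩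

open Path.Homotopic in
/-- A space that is the union of two simply connected open sets with path connected intersection
is simply connected. -/
theorem simplyConnectedSpace_of_union {X : Type*} [TopologicalSpace X] {U V : Set X}
    (hUo : IsOpen U) (hVo : IsOpen V) (hU : IsSimplyConnected U) (hV : IsSimplyConnected V)
    (hUV : ∀ x, x ∈ U ∨ x ∈ V) (hI : IsPathConnected (U ∩ V)) : SimplyConnectedSpace X := by
  obtain ⟨x₀, hx₀, hj⟩ := hI
  -- A reference path to each point, in `U ∩ V` whenever `p` lies there. It is then homotopic to
  -- every path from `x₀` to `p` that stays in `U`, and to every one that stays in `V`.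
  have hc : ∀ p, ∃ c : Path x₀ p,
      (∀ δ : Path x₀ p, (∀ s, δ s ∈ U) → δ.Homotopic c) ∧
      (∀ δ : Path x₀ p, (∀ s, δ s ∈ V) → δ.Homotopic c) := by
    intro p
    by_cases hpU : p ∈ U
    · by_cases hpV : p ∈ V
      · have hJ := hj ⟨hpU, hpV⟩
        exact ⟨hJ.somePath,
          fun δ hδ => homotopic_of_range_subset hU _ _ hδ fun s => (hJ.somePath_mem s).1,
          fun δ hδ => homotopic_of_range_subset hV _ _ hδ fun s => (hJ.somePath_mem s).2⟩
      · have hJ := hU.isPathConnected.joinedIn x₀ hx₀.1 p hpU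
        exact ⟨hJ.somePath,
          fun δ hδ => homotopic_of_range_subset hU _ _ hδ fun s => hJ.somePath_mem s,
          fun δ hδ => (hpV (by simpa using hδ 1)).elim⟩
    · have hpV := (hUV p).resolve_left hpU
      have hJ := hV.isPathConnected.joinedIn x₀ hx₀.2 p hpV
      exact ⟨hJ.somePath, fun δ hδ => (hpU (by simpa using hδ 1)).elim,
        fun δ hδ => homotopic_of_range_subset hV _ _ hδ fun s => hJ.somePath_mem s⟩
  choose c hcU hcV using hc
  have key : ∀ W : Set X, IsSimplyConnected W → x₀ ∈ W →
      (∀ p, ∀ δ : Path x₀ p, (∀ s, δ s ∈ W) → δ.Homotopic (c p)) →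
      ∀ p q (γ : Path p q), (∀ s, γ s ∈ W) → ((c p).trans γ).Homotopic (c q) := by
    intro W hW h0 hcW p q γ hγ
    have hJ := hW.isPathConnected.joinedIn x₀ h0 p (by simpa using hγ 0)
    refine ((hcW p _ hJ.somePath_mem).symm.hcomp (Path.Homotopic.refl γ)).trans (hcW q _ fun s => ?_)
    have : (hJ.somePath.trans γ) s ∈ range (hJ.somePath.trans γ) := mem_range_self s
    rw [Path.trans_range] at this
    rcases this with ⟨u, hu⟩ | ⟨u, hu⟩
    · exact hu ▸ hJ.somePath_mem u
    · exact hu ▸ hγ u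
  -- Cut `γ` into finitely many pieces, each inside `U` or `V`, and absorb them one at a time into
  -- the reference path by `key`.
  have main : ∀ p q (γ : Path p q), ((c p).trans γ).Homotopic (c q) := by
    intro p q γ
    obtain ⟨t, ht0, htm, ⟨n, hn⟩, ht⟩ := exists_monotone_Icc_subset_open_cover_unitInterval
      (ι := Bool) (c := fun b => γ ⁻¹' (cond b U V))
      (by rintro (_ | _); exacts [hVo.preimage γ.continuous, hUo.preimage γ.continuous])
      (fun s _ => by
        rcases hUV (γ s) with h | h
        · exact mem_iUnion.2 ⟨true, h⟩
        · exact mem_iUnion.2 ⟨false, h⟩)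
    have step : ∀ k, ((c (γ 0)).trans (γ.subpath 0 (t k))).Homotopic (c (γ (t k))) := by
      intro k
      induction k with
      | zero =>
        rw [ht0, Path.subpath_self]
        exact ⟨Path.Homotopy.transRefl _⟩
      | succ k ih =>
        have h₁ : ((c (γ (t k))).trans (γ.subpath (t k) (t (k + 1)))).Homotopic
            (c (γ (t (k + 1)))) := by
          have hr : ∀ s, ∃ u ∈ Icc (t k) (t (k + 1)), γ u = γ.subpath (t k) (t (k + 1)) s := by
            intro s
            have := mem_range_self (f := γ.subpath (t k) (t (k + 1))) s
            rw [Path.range_subpath_of_le _ _ _ (htm k.le_succ)] at this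
            exact this
          obtain ⟨b, hb⟩ := ht k
          cases b
          · refine key V hV hx₀.2 hcV _ _ _ fun s => ?_
            obtain ⟨u, hu, hus⟩ := hr s
            exact hus ▸ hb hu
          · refine key U hU hx₀.1 hcU _ _ _ fun s => ?_
            obtain ⟨u, hu, hus⟩ := hr s
            exact hus ▸ hb hu
        have h₂ : ((γ.subpath 0 (t k)).trans (γ.subpath (t k) (t (k + 1)))).Homotopic
            (γ.subpath 0 (t (k + 1))) := ⟨Path.Homotopy.subpathTransSubpath _ _ _ _⟩
        exact ((Path.Homotopic.refl _).hcomp h₂.symm).trans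
          (Path.Homotopic.trans ⟨(Path.Homotopy.transAssoc _ _ _).symm⟩
            ((ih.hcomp (Path.Homotopic.refl _)).trans h₁))
    have h := step n
    rw [hn n le_rfl, Path.subpath_zero_one] at h
    -- The induction ends at `γ 0` and `γ 1`, which are equal to `p` and `q` but not syntactically
    -- so.
    have hcast : ∀ p' q' (hp : p' = p) (hq : q' = q),
        ((c p').trans (γ.cast hp hq)).Homotopic (c q') → ((c p).trans γ).Homotopic (c q) := by
      rintro _ _ rfl rfl h
      exact h
    exact hcast _ _ _ _ h
  rw [simply_connected_iff_paths_homotopic']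
  refine ⟨⟨⟨x₀⟩, fun p q => ⟨(c p).symm.trans (c q)⟩⟩, fun {p q} γ γ' => ?_⟩
  -- Both paths become homotopic to `c q` after `c p`; cancelling `c p` on the left makes them
  -- homotopic to each other.
  have h := (main p q γ).trans (main p q γ').symm
  rw [← Path.Homotopic.Quotient.eq] at h ⊢
  simp only [Path.Homotopic.Quotient.mk_trans] at h
  have h' := congrArg (Path.Homotopic.Quotient.trans (Path.Homotopic.Quotient.mk (c p)).symm) h
  simpa only [← Path.Homotopic.Quotient.trans_assoc, Path.Homotopic.Quotient.symm_trans,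
    Path.Homotopic.Quotient.refl_trans] using h'

/-! ### Sections of translation-invariant cones -/

section Cone

variable {E : Type*} [AddCommGroup E] [Module ℝ E] [TopologicalSpace E] [IsTopologicalAddGroup E]
  [ContinuousSMul ℝ E]

/-- A section `Z` of a cone `K` that is stable under translations along `e` retracts, away from
`-e`, to `e` along normalized straight lines. -/
theorem contractibleSpace_compl_neg {Q : E → ℝ} (hQc : Continuous Q)
    (hQs : ∀ (c : ℝ) x, Q (c • x) = c ^ 2 * Q x) (hQd : ∀ x, x ≠ 0 → 0 < Q x) {K Z : Set E}
    (hZ : ∀ x, x ∈ Z ↔ x ∈ K ∧ Q x = 1) (hKs : ∀ (c : ℝ) x, x ∈ K → c • x ∈ K) {e : E}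
    (hKe : ∀ (c : ℝ) x, x ∈ K → x + c • e ∈ K) (he : e ∈ Z) :
    ContractibleSpace {x : Z | (x : E) ≠ -e} := by
  have hQe := ((hZ e).1 he).2
  have he0 : e ≠ 0 := by
    rintro rfl
    have := hQs 0 0
    simp only [zero_smul] at this
    rw [hQe] at this
    norm_num at this
  let l : unitInterval → E → E := fun τ x => (1 - (τ : ℝ)) • x + (τ : ℝ) • e
  -- The segment from `x` to `e` avoids the whole ray spanned by `-e`. Otherwise `x` would be
  -- proportional to `e` with a nonpositive factor, and `Q x = Q e = 1` would give `x = -e`. The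
  -- case `s = 0` permits normalization; the case `s = √(Q (l τ x))` shows that the normalized point
  -- is not `-e`.
  have hl : ∀ (τ : unitInterval) (x : E), Q x = 1 → x ≠ -e → ∀ s : ℝ, 0 ≤ s →
      l τ x ≠ -(s • e) := by
    intro τ x hx hxe s hs h
    have h₁ : (1 - (τ : ℝ)) • x = (-(s + τ)) • e := by
      have : (1 - (τ : ℝ)) • x = -(s • e) - (τ : ℝ) • e := by rw [← h]; simp [l]
      rw [this]
      module
    have h₂ := congrArg Q h₁
    rw [hQs, hQs, hx, hQe] at h₂
    have h₃ : (1 - (τ : ℝ)) = s + τ := by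
      have := τ.2.1
      have := τ.2.2
      nlinarith
    have h₄ : (1 - (τ : ℝ)) ≠ 0 := by
      have := τ.2.1
      intro h
      linarith
    rw [neg_smul, ← h₃, ← smul_neg] at h₁
    exact hxe (smul_right_injective E h₄ h₁)
  have hlQ : ∀ (τ : unitInterval) (x : E), Q x = 1 → x ≠ -e → 0 < Q (l τ x) := fun τ x hx hxe =>
    hQd _ fun h => hl τ x hx hxe 0 le_rfl (by simpa using h)
  let n : unitInterval → E → E := fun τ x => (√(Q (l τ x)))⁻¹ • l τ x
  have hnZ : ∀ τ (x : {x : Z | (x : E) ≠ -e}), n τ x ∈ Z := by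
    intro τ x
    have hx := (hZ _).1 x.1.2
    have hpos := hlQ τ x hx.2 x.2
    refine (hZ _).2 ⟨hKs _ _ (hKe _ _ (hKs _ _ hx.1)), ?_⟩
    rw [hQs, inv_pow, Real.sq_sqrt hpos.le, inv_mul_cancel₀ hpos.ne']
  have hne : ∀ τ (x : {x : Z | (x : E) ≠ -e}), n τ x ≠ -e := by
    intro τ x h
    have hx := (hZ _).1 x.1.2
    have hpos := Real.sqrt_pos.2 (hlQ τ x hx.2 x.2)
    refine hl τ x hx.2 x.2 _ hpos.le ?_
    rw [← smul_neg]
    refine Eq.trans ?_ (congrArg (√(Q (l τ x)) • ·) h)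
    simp [n, hpos.ne']
  have hee : e ≠ -e := by
    intro h
    have : (2 : ℝ) • e = 0 := by rw [two_smul]; nth_rewrite 1 [h]; simp
    simp [he0] at this
  have hlc : Continuous fun p : unitInterval × {x : Z | (x : E) ≠ -e} => l p.1 p.2 := by
    fun_prop
  have hF : Continuous fun p : unitInterval × {x : Z | (x : E) ≠ -e} => n p.1 p.2 := by
    refine Continuous.smul (Continuous.inv₀ (hQc.comp hlc).sqrt fun p => ?_) hlc
    exact (Real.sqrt_pos.2 (hlQ _ _ ((hZ _).1 p.2.1.2).2 p.2.2)).ne'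
  rw [contractible_iff_id_nullhomotopic]
  refine ⟨⟨⟨e, he⟩, hee⟩, ⟨⟨⟨fun p => ⟨⟨n p.1 p.2, hnZ _ _⟩, hne _ _⟩, ?_⟩, ?_, ?_⟩⟩⟩
  · exact Continuous.subtype_mk (Continuous.subtype_mk hF _) _
  · intro x
    refine Subtype.ext (Subtype.ext ?_)
    simp [n, l, ((hZ _).1 x.1.2).2]
  · intro x
    refine Subtype.ext (Subtype.ext ?_)
    simp [n, l, hQe]

/-- The complements of `-e` and of `e` are open and contractible, the second by the same retraction
with `-e` in place of `e`; `hpc` is the path connectedness of their intersection. -/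
theorem simplyConnectedSpace_of_cone [T1Space E] {Q : E → ℝ} (hQc : Continuous Q)
    (hQs : ∀ (c : ℝ) x, Q (c • x) = c ^ 2 * Q x) (hQd : ∀ x, x ≠ 0 → 0 < Q x) {K Z : Set E}
    (hZ : ∀ x, x ∈ Z ↔ x ∈ K ∧ Q x = 1) (hKs : ∀ (c : ℝ) x, x ∈ K → c • x ∈ K) {e : E}
    (hKe : ∀ (c : ℝ) x, x ∈ K → x + c • e ∈ K) (he : e ∈ Z)
    (hpc : IsPathConnected {x | x ∈ Z ∧ x ≠ e ∧ x ≠ -e}) : SimplyConnectedSpace Z := by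
  have he' : -e ∈ Z := by
    refine (hZ _).2 ⟨?_, ?_⟩
    · simpa using hKs (-1) e ((hZ e).1 he).1
    · simpa [((hZ e).1 he).2] using hQs (-1) e
  have hU := contractibleSpace_compl_neg hQc hQs hQd hZ hKs hKe he
  have hV := contractibleSpace_compl_neg hQc hQs hQd hZ hKs (e := -e)
    (fun c x hx => by simpa using hKe (-c) x hx) he'
  rw [neg_neg] at hV
  have hee : e ≠ -e := by
    intro h
    have h2 : (2 : ℝ) • e = 0 := by rw [two_smul]; nth_rewrite 1 [h]; simp
    have h0 : e = 0 := by simpa using h2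
    have := hQs 0 0
    simp only [zero_smul] at this
    rw [h0] at he
    rw [((hZ _).1 he).2] at this
    norm_num at this
  refine simplyConnectedSpace_of_union (U := {x : Z | (x : E) ≠ -e}) (V := {x : Z | (x : E) ≠ e})
    (isOpen_ne.preimage continuous_subtype_val) (isOpen_ne.preimage continuous_subtype_val)
    (inferInstanceAs (SimplyConnectedSpace _)) (inferInstanceAs (SimplyConnectedSpace _))
    (fun x => ?_) ?_
  · by_cases h : (x : E) = e
    · left
      change (x : E) ≠ -e
      rwa [h]
    · exact Or.inr h
  · rw [Topology.IsInducing.subtypeVal.isPathConnected_iff]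
    convert! hpc using 1
    ext x
    simp only [mem_image, mem_inter_iff, mem_ofPred_eq, Subtype.exists, exists_and_right,
      exists_eq_right, ne_eq]
    tauto

end Cone

/-! ### Spheres and the fundamental groups of the model spaces -/

/-- A sphere of dimension at least two minus a pair of antipodal points is path connected. -/
theorem isPathConnected_sphere_diff {F : Type*} [NormedAddCommGroup F] [NormedSpace ℝ F]
    (hF : 2 < Module.finrank ℝ F) {e : F} (he : ‖e‖ = 1) :
    IsPathConnected {x : F | x ∈ Metric.sphere (0 : F) 1 ∧ x ≠ e ∧ x ≠ -e} := by
  have : FiniteDimensional ℝ F := FiniteDimensional.of_finrank_pos (by lia)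
  have he0 : e ≠ 0 := by rintro rfl; simp at he
  have h₁ := (Submodule.span ℝ {e}).finrank_quotient_add_finrank
  rw [finrank_span_singleton he0] at h₁
  -- The line through `e` has codimension at least two. Radial projection maps its complement onto
  -- the sphere minus `±e`.
  have h₂ : IsPathConnected ((Submodule.span ℝ {e} : Submodule ℝ F) : Set F)ᶜ :=
    isPathConnected_compl_of_one_lt_codim
      (by exact_mod_cast Module.lt_rank_of_lt_finrank (n := 1) (by lia))
  have h₃ := h₂.image' (f := fun x => ‖x‖⁻¹ • x) (ContinuousOn.smul
    (continuousOn_id.norm.inv₀ fun x hx h => hx (by simp_all)) continuousOn_id)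
  convert! h₃ using 1
  ext x
  simp only [mem_image, mem_ofPred_eq, mem_compl_iff, SetLike.mem_coe, mem_sphere_zero_iff_norm,
    Submodule.mem_span_singleton, not_exists]
  constructor
  · rintro ⟨hx, hxe, hxe'⟩
    refine ⟨x, fun a ha => ?_, by simp [hx]⟩
    have hn := congrArg norm ha
    rw [norm_smul, he, hx, mul_one, Real.norm_eq_abs] at hn
    rcases eq_or_eq_neg_of_abs_eq hn with rfl | rfl
    · exact hxe (by simpa using ha.symm)
    · exact hxe' (by simpa using ha.symm)
  · rintro ⟨y, hy, rfl⟩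
    have hy0 : ‖y‖ ≠ 0 := by
      intro h
      exact hy 0 (by simpa using (norm_eq_zero.1 h).symm)
    have hy' : ∀ z, ‖y‖⁻¹ • y = z → ‖y‖ • z = y := by
      rintro _ rfl
      exact smul_inv_smul₀ hy0 y
    refine ⟨by simp [norm_smul, hy0], fun h => hy ‖y‖ (hy' _ h), fun h => hy (-‖y‖) ?_⟩
    rw [neg_smul, ← smul_neg]
    exact hy' _ h

/-- The cone is the whole space here, and any unit vector serves as `e`. -/
theorem simplyConnectedSpace_sphere {F : Type*} [NormedAddCommGroup F] [NormedSpace ℝ F]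
    (hF : 2 < Module.finrank ℝ F) : SimplyConnectedSpace (Metric.sphere (0 : F) 1) := by
  have : Nontrivial F := Module.nontrivial_of_finrank_pos (R := ℝ) (by lia)
  obtain ⟨e, he⟩ := exists_norm_eq F zero_le_one
  exact simplyConnectedSpace_of_cone (Q := fun x => ‖x‖ ^ 2) (K := univ) (e := e) (by fun_prop)
    (fun c x => by simp [norm_smul, mul_pow]) (fun x hx => by positivity)
    (fun x => by
      simp only [mem_sphere_zero_iff_norm, mem_univ, true_and]
      rw [pow_eq_one_iff_of_nonneg (norm_nonneg x) two_ne_zero])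
    (fun _ _ _ => mem_univ _) (fun _ _ _ => mem_univ _) (by simpa using he)
    (isPathConnected_sphere_diff hF he)

theorem nonempty_fundamentalGroup_sphere_prod_circle
    (y : Metric.sphere (0 : EuclideanSpace ℝ (Fin 3)) 1 × Circle) :
    Nonempty (FundamentalGroup (Metric.sphere (0 : EuclideanSpace ℝ (Fin 3)) 1 × Circle) y ≃*
      Multiplicative ℤ) := by
  have := simplyConnectedSpace_sphere (F := EuclideanSpace ℝ (Fin 3)) (by simp)
  obtain ⟨e⟩ := nonempty_fundamentalGroup_circle y.2
  have : Unique (FundamentalGroup (Metric.sphere (0 : EuclideanSpace ℝ (Fin 3)) 1) y.1) :=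
    uniqueOfSubsingleton 1
  exact ⟨((fundamentalGroupProd y.1 y.2).trans MulEquiv.uniqueProd).trans e⟩

theorem nonempty_fundamentalGroup_torus_prod_Ioo (y : Circle × Circle × Ioo (-1 : ℝ) 1) :
    Nonempty (FundamentalGroup (Circle × Circle × Ioo (-1 : ℝ) 1) y ≃*
      Multiplicative (ℤ × ℤ)) := by
  obtain ⟨e₁⟩ := nonempty_fundamentalGroup_circle y.1
  obtain ⟨e₂⟩ := nonempty_fundamentalGroup_circle y.2.1
  have : ContractibleSpace (Ioo (-1 : ℝ) 1) := (convex_Ioo _ _).contractibleSpace ⟨0, by simp⟩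
  have : Unique (FundamentalGroup (Ioo (-1 : ℝ) 1) y.2.2) := uniqueOfSubsingleton 1
  exact ⟨((fundamentalGroupProd y.1 y.2).trans (e₁.prodCongr
    (((fundamentalGroupProd y.2.1 y.2.2).trans MulEquiv.prodUnique).trans e₂))).trans
      (MulEquiv.prodMultiplicative _ _).symm⟩

/-! ### Explicit equations, the non-simple vertex and the reflections -/

theorem mem_quadricIntersection_tuple {t : ℝ} {x : Fin 5 → ℝ} :
    x ∈ quadricIntersection (tuple t) ↔
      -x 0 ^ 2 - x 1 ^ 2 + t * x 2 ^ 2 + x 3 ^ 2 + x 4 ^ 2 = 0 ∧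
        x 0 ^ 2 + x 1 ^ 2 + x 2 ^ 2 + x 3 ^ 2 + x 4 ^ 2 = 1 := by
  simp only [quadricIntersection, quadricMap, tuple, mem_ofPred_eq, Prod.mk.injEq, funext_iff,
    Fin.forall_fin_one, Fin.sum_univ_five]
  simp
  grind

theorem mem_polytope_tuple {t : ℝ} {r : Fin 5 → ℝ} :
    r ∈ polytope (tuple t) ↔ (∀ i, 0 ≤ r i) ∧ -r 0 - r 1 + t * r 2 + r 3 + r 4 = 0 ∧
      r 0 + r 1 + r 2 + r 3 + r 4 = 1 := by
  simp only [polytope, tuple, mem_ofPred_eq, funext_iff,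
    Fin.forall_fin_one, Fin.sum_univ_five]
  simp
  grind

theorem mem_pyramidSpace {x : Fin 5 → ℝ} :
    x ∈ pyramidSpace ↔ x 0 ^ 2 + x 1 ^ 2 = (1 - x 2 ^ 2) / 2 ∧
      x 3 ^ 2 + x 4 ^ 2 = (1 - x 2 ^ 2) / 2 := by
  rw [pyramidSpace, mem_quadricIntersection_tuple]
  constructor <;> rintro ⟨h, h'⟩ <;> constructor <;> linarith

theorem mem_pointsOver_apex {x : Fin 5 → ℝ} :
    x ∈ pointsOver (tuple 0) {apex} ↔ x ∈ pyramidSpace ∧ x 2 ^ 2 = 1 := by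
  simp only [pointsOver, mem_ofPred_eq, mem_singleton_iff, pyramidSpace]
  refine and_congr_right fun hx => ⟨fun h => by simpa [apex] using congrFun h 2, fun h => ?_⟩
  have h' := mem_pyramidSpace.1 hx
  have h0 : x 0 ^ 2 = 0 := by nlinarith [sq_nonneg (x 0), sq_nonneg (x 1)]
  have h1 : x 1 ^ 2 = 0 := by nlinarith [sq_nonneg (x 0), sq_nonneg (x 1)]
  have h3 : x 3 ^ 2 = 0 := by nlinarith [sq_nonneg (x 3), sq_nonneg (x 4)]
  have h4 : x 4 ^ 2 = 0 := by nlinarith [sq_nonneg (x 3), sq_nonneg (x 4)]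
  funext i
  fin_cases i <;> simp [apex, h, h0, h1, h3, h4]

theorem mem_puncturedPyramidSpace {x : Fin 5 → ℝ} :
    x ∈ puncturedPyramidSpace ↔ x 0 ^ 2 + x 1 ^ 2 = (1 - x 2 ^ 2) / 2 ∧
      x 3 ^ 2 + x 4 ^ 2 = (1 - x 2 ^ 2) / 2 ∧ x 2 ^ 2 < 1 := by
  rw [puncturedPyramidSpace, mem_sdiff, mem_pointsOver_apex, mem_pyramidSpace]
  constructor
  · rintro ⟨⟨h, h'⟩, hn⟩
    refine ⟨h, h', lt_of_le_of_ne (by nlinarith [sq_nonneg (x 0), sq_nonneg (x 1)]) ?_⟩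
    tauto
  · rintro ⟨h, h', hn⟩
    exact ⟨⟨h, h'⟩, fun hh => hn.ne hh.2⟩

theorem mem_drilledPrismSpace {t : ℝ} {x : Fin 5 → ℝ} :
    x ∈ drilledPrismSpace t ↔ x ∈ prismSpace t ∧
      0 < x 0 ^ 2 + x 1 ^ 2 ∧ 0 < x 3 ^ 2 + x 4 ^ 2 := by
  have h := fun a b : ℝ => add_nonneg (sq_nonneg a) (sq_nonneg b)
  have hs : ∀ a b : ℝ, 0 < a ^ 2 + b ^ 2 ↔ ¬(a ^ 2 = 0 ∧ b ^ 2 = 0) := by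
    intro a b
    rw [(h a b).lt_iff_ne', ne_eq, add_eq_zero_iff_of_nonneg (sq_nonneg a) (sq_nonneg b)]
  rw [hs, hs, drilledPrismSpace, mem_sdiff]
  refine and_congr_right fun hx => ?_
  have : (fun i => x i ^ 2) ∈ prism t := by
    rw [prism, mem_polytope_tuple]
    rw [prismSpace, mem_quadricIntersection_tuple] at hx
    exact ⟨fun i => sq_nonneg _, hx⟩
  simp only [pointsOver, newEdge, mem_ofPred_eq, this, true_and, not_and, not_or]
  constructor
  · intro hh
    exact hh hx
  · intro hh _
    exact hh

/-- More than three zeros among five coordinates leave at most one nonzero coordinate. The linear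
equation kills it unless it is `v 2`, whose coefficient is `0`. -/
theorem extremePoints_pyramid :
    {v ∈ pyramid.extremePoints ℝ | 3 < {i | v i = 0}.ncard} = {apex} := by
  ext v
  simp only [mem_ofPred_eq, mem_singleton_iff]
  constructor
  · rintro ⟨⟨hv, -⟩, h⟩
    rw [pyramid, mem_polytope_tuple] at hv
    obtain ⟨hp, h1, h2⟩ := hv
    have key : ∀ a b : Fin 5, a ≠ b → v a = 0 ∨ v b = 0 := by
      intro a b hab
      by_contra! hc
      have hsub : {i | v i = 0} ⊆ (({a, b} : Finset (Fin 5))ᶜ : Finset (Fin 5)) := by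
        intro i hi
        simp only [Finset.coe_compl, mem_compl_iff, Finset.mem_coe, Finset.mem_insert,
          Finset.mem_singleton, not_or]
        constructor <;> rintro rfl
        exacts [hc.1 hi, hc.2 hi]
      have := ncard_le_ncard hsub (Finset.finite_toSet _)
      rw [ncard_coe_finset, Finset.card_compl, Finset.card_pair hab, Fintype.card_fin] at this
      lia
    have h01 := key 0 1 (by decide)
    have h03 := key 0 3 (by decide)
    have h04 := key 0 4 (by decide)
    have h13 := key 1 3 (by decide)
    have h14 := key 1 4 (by decide)
    have h34 := key 3 4 (by decide)
    have : v 0 = 0 ∧ v 1 = 0 ∧ v 3 = 0 ∧ v 4 = 0 := by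
      have := hp 0; have := hp 1; have := hp 3; have := hp 4
      grind
    obtain ⟨a0, a1, a3, a4⟩ := this
    funext i
    fin_cases i <;> simp [apex, a0, a1, a3, a4]
    linarith
  · rintro rfl
    refine ⟨⟨?_, ?_⟩, ?_⟩
    · rw [pyramid, mem_polytope_tuple]
      refine ⟨fun i => ?_, by simp [apex], by simp [apex]⟩
      fin_cases i <;> simp [apex]
    · intro y hy z hz hyz
      rw [pyramid, mem_polytope_tuple] at hy hz
      obtain ⟨a, b, ha, hb, hab, h⟩ := hyz
      have hzero : ∀ i, apex i = 0 → y i = 0 := by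
        intro i hi
        have hh := congrFun h i
        simp only [Pi.add_apply, Pi.smul_apply, smul_eq_mul, hi] at hh
        have := mul_nonneg ha.le (hy.1 i)
        have := mul_nonneg hb.le (hz.1 i)
        have : a * y i = 0 := by linarith
        simpa [ha.ne'] using this
      have a0 := hzero 0 (by simp [apex])
      have a1 := hzero 1 (by simp [apex])
      have a3 := hzero 3 (by simp [apex])
      have a4 := hzero 4 (by simp [apex])
      funext i
      fin_cases i <;> simp [apex, a0, a1, a3, a4]
      linarith [hy.2.2]
    · have : {i | apex i = 0} = (({2} : Finset (Fin 5))ᶜ : Finset (Fin 5)) := by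
        ext i
        fin_cases i <;> simp [apex]
      rw [this, ncard_coe_finset, Finset.card_compl]
      simp

theorem mem_reflections_polytope {t : ℝ} {y : Fin 5 → ℝ} :
    y ∈ reflections (polytope (tuple t)) ↔ (fun i => |y i|) ∈ polytope (tuple t) := by
  simp only [reflections, mem_iUnion, mem_image]
  constructor
  · rintro ⟨ε, r, hr, rfl⟩
    convert! hr using 1
    funext i
    rcases Int.units_eq_one_or (ε i) with h | h <;>
      simp [reflect, h, abs_of_nonneg ((mem_polytope_tuple.1 hr).1 i)]
  · intro h
    -- The signs of `y`, with zero counted as positive, unfold `|y|` to `y`.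
    refine ⟨fun i => if 0 ≤ y i then 1 else -1, _, h, ?_⟩
    funext i
    by_cases hi : 0 ≤ y i
    · simp [reflect, hi, abs_of_nonneg hi]
    · simp [reflect, hi, abs_of_neg (not_le.1 hi)]

/-- The homeomorphism `a ↦ a |a|` of the real line. -/
def mulAbsHomeomorph : ℝ ≃ₜ ℝ where
  toFun a := a * |a|
  invFun b := √b - √(-b)
  left_inv a := by
    rcases le_total 0 a with h | h
    · have : -(a * a) ≤ 0 := by nlinarith
      simp [abs_of_nonneg h, Real.sqrt_eq_zero_of_nonpos this, h]
    · have : -(a * a) ≤ 0 := by nlinarith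
      beta_reduce
      rw [abs_of_nonpos h, mul_neg, neg_neg, Real.sqrt_eq_zero_of_nonpos this,
        Real.sqrt_mul_self_eq_abs, abs_of_nonpos h]
      ring
  right_inv b := by
    rcases le_total 0 b with h | h
    · simp [Real.sqrt_eq_zero_of_nonpos (neg_nonpos.2 h), h, abs_of_nonneg]
    · simp [Real.sqrt_eq_zero_of_nonpos h, h, abs_of_nonneg]
  continuous_toFun := by fun_prop
  continuous_invFun := by fun_prop

theorem exists_homeomorph_reflections (t : ℝ) :
    ∃ g : quadricIntersection (tuple t) ≃ₜ reflections (polytope (tuple t)),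
      ∀ x i, (g x : Fin 5 → ℝ) i = (x : Fin 5 → ℝ) i * |(x : Fin 5 → ℝ) i| := by
  refine ⟨(Homeomorph.piCongrRight fun _ : Fin 5 => mulAbsHomeomorph).subtype fun x => ?_,
    fun x i => rfl⟩
  rw [mem_reflections_polytope, mem_polytope_tuple, mem_quadricIntersection_tuple]
  have : ∀ i, |Homeomorph.piCongrRight (fun _ : Fin 5 => mulAbsHomeomorph) x i| = x i ^ 2 := by
    intro i
    change abs (x i * |x i|) = x i ^ 2
    rw [abs_mul, abs_abs, ← sq, sq_abs]
  simp only [this, sq_nonneg, implies_true, true_and]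

/-! ### The smooth part -/

theorem fderiv_quadricMap_apply {n m : ℕ} (A : Fin n → Fin m → ℝ) (x v : Fin n → ℝ) :
    fderiv ℝ (quadricMap A) x v = (∑ i, (2 * x i * v i) • A i, ∑ i, 2 * x i * v i) := by
  have h : ∀ i, HasFDerivAt (fun x : Fin n → ℝ => x i ^ 2)
      ((2 * x i) • ContinuousLinearMap.proj (R := ℝ) (φ := fun _ : Fin n => ℝ) i) x := by
    intro i
    simpa using (ContinuousLinearMap.proj (R := ℝ) (φ := fun _ : Fin n => ℝ) i).hasFDerivAt.pow 2
  have h₁ := (HasFDerivAt.fun_sum fun i (_ : i ∈ Finset.univ) => (h i).smul_const (A i)).prodMk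
    (HasFDerivAt.fun_sum fun i (_ : i ∈ Finset.univ) => h i)
  rw [show quadricMap A = fun x => (∑ i, x i ^ 2 • A i, ∑ i, x i ^ 2) from rfl, h₁.fderiv]
  simp

/-- Over the apex only `x 2` is nonzero and it is absent from the first equation, whose differential
therefore vanishes. Elsewhere both blocks are nonzero, and stretching them radially at independent
rates produces every value. -/
theorem smoothPart_tuple_zero : smoothPart (tuple 0) = puncturedPyramidSpace := by
  ext x
  rw [smoothPart, mem_ofPred_eq]
  change x ∈ pyramidSpace ∧ _ ↔ _
  rw [mem_puncturedPyramidSpace, ← and_assoc, ← mem_pyramidSpace]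
  refine and_congr_right fun hx => ?_
  rw [mem_pyramidSpace] at hx
  obtain ⟨ha, hb⟩ := hx
  constructor
  · intro hs
    by_contra! h
    have h0 : x 0 = 0 := by
      by_contra h0; have := sq_nonneg (x 1); have := sq_pos_of_ne_zero h0; linarith
    have h1 : x 1 = 0 := by
      by_contra h0; have := sq_nonneg (x 0); have := sq_pos_of_ne_zero h0; linarith
    have h3 : x 3 = 0 := by
      by_contra h0; have := sq_nonneg (x 4); have := sq_pos_of_ne_zero h0; linarith
    have h4 : x 4 = 0 := by
      by_contra h0; have := sq_nonneg (x 3); have := sq_pos_of_ne_zero h0; linarith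
    obtain ⟨v, hv⟩ := hs (fun _ => 1, 0)
    rw [fderiv_quadricMap_apply] at hv
    have := congrFun (congrArg Prod.fst hv) 0
    simp [Fin.sum_univ_five, tuple, h0, h1, h3, h4] at this
  · rintro h ⟨w, s⟩
    have ha0 : x 0 ^ 2 + x 1 ^ 2 ≠ 0 := by
      intro h0
      linarith
    have hb0 : x 3 ^ 2 + x 4 ^ 2 = x 0 ^ 2 + x 1 ^ 2 := by rw [ha, hb]
    set a := x 0 ^ 2 + x 1 ^ 2 with hadef
    -- Stretching rates `λ`, `μ` of the blocks give the derivative `(2a(μ - λ), 2a(μ + λ))`; the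
    -- coefficients solve for `(w 0, s)`.
    refine ⟨![(s - w 0) / (4 * a) * x 0, (s - w 0) / (4 * a) * x 1, 0,
      (s + w 0) / (4 * a) * x 3, (s + w 0) / (4 * a) * x 4], ?_⟩
    rw [fderiv_quadricMap_apply]
    have h₁ : (s - w 0) / (4 * a) * (x 0 ^ 2 + x 1 ^ 2) = (s - w 0) / 4 := by
      rw [← hadef]; field_simp
    have h₂ : (s + w 0) / (4 * a) * (x 3 ^ 2 + x 4 ^ 2) = (s + w 0) / 4 := by
      rw [hb0]; field_simp
    refine Prod.ext (funext fun i => ?_) ?_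
    · fin_cases i
      simp [Fin.sum_univ_five, tuple]
      linear_combination (-2) * h₁ + 2 * h₂
    · simp [Fin.sum_univ_five]
      linear_combination 2 * h₁ + 2 * h₂

/-! ### Rescaling the punctured pyramid space onto the drilled prism space -/

@[fun_prop]
theorem continuous_coe_apply (S : Set (Fin 5 → ℝ)) (i : Fin 5) :
    Continuous fun x : S => (x : Fin 5 → ℝ) i :=
  (continuous_apply i).comp continuous_subtype_val

/-- Scaling by `α`, `β` and `γ` along the coordinate blocks `(0, 1)`, `(3, 4)` and `2`. -/
def blockScale (α β γ : ℝ) (x : Fin 5 → ℝ) : Fin 5 → ℝ :=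
  ![α * x 0, α * x 1, γ * x 2, β * x 3, β * x 4]

theorem blockScale_blockScale {α β γ α' β' γ' : ℝ} (x : Fin 5 → ℝ) (hα : α' * α = 1)
    (hβ : β' * β = 1) (hγ : γ' * γ = 1) : blockScale α' β' γ' (blockScale α β γ x) = x := by
  funext i
  fin_cases i <;> simp [blockScale, ← mul_assoc, hα, hβ, hγ]

theorem sign_blockScale {α β γ : ℝ} (hα : 0 < α) (hβ : 0 < β) (hγ : 0 < γ) (x : Fin 5 → ℝ)
    (i : Fin 5) : SignType.sign (blockScale α β γ x i) = SignType.sign (x i) := by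
  fin_cases i <;> simp [blockScale, sign_mul, sign_pos, hα, hβ, hγ]

theorem blockScale_reflect (α β γ : ℝ) (ε : Fin 5 → ℤˣ) (x : Fin 5 → ℝ) :
    blockScale α β γ (reflect ε x) = reflect ε (blockScale α β γ x) := by
  funext i
  fin_cases i <;> simp [blockScale, reflect] <;> ring

theorem reflect_sq (ε : Fin 5 → ℤˣ) (x : Fin 5 → ℝ) (i : Fin 5) :
    reflect ε x i ^ 2 = x i ^ 2 := by
  rcases Int.units_eq_one_or (ε i) with h | h <;> simp [reflect, h]

theorem continuous_blockScale {X : Type*} [TopologicalSpace X] {α β γ : X → ℝ}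
    {f : X → Fin 5 → ℝ} (hα : Continuous α) (hβ : Continuous β) (hγ : Continuous γ)
    (hf : Continuous f) : Continuous fun x => blockScale (α x) (β x) (γ x) (f x) := by
  refine continuous_pi fun i => ?_
  fin_cases i <;> simp [blockScale] <;> fun_prop

/-- The map from the punctured pyramid space to the drilled prism space for `t = p - q`. -/
def drill (p q : ℝ) (x : Fin 5 → ℝ) : Fin 5 → ℝ :=
  blockScale √((x 0 ^ 2 + x 1 ^ 2 + p * (x 2 ^ 2 / (1 + p + q))) / (x 0 ^ 2 + x 1 ^ 2))
    √((x 3 ^ 2 + x 4 ^ 2 + q * (x 2 ^ 2 / (1 + p + q))) / (x 3 ^ 2 + x 4 ^ 2))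
    (√(1 + p + q))⁻¹ x

/-- The map from the drilled prism space for `t = p - q` to the punctured pyramid space. -/
def undrill (p q : ℝ) (y : Fin 5 → ℝ) : Fin 5 → ℝ :=
  blockScale √((1 - (1 + p + q) * y 2 ^ 2) / 2 / (y 0 ^ 2 + y 1 ^ 2))
    √((1 - (1 + p + q) * y 2 ^ 2) / 2 / (y 3 ^ 2 + y 4 ^ 2)) √(1 + p + q) y

section Drill

variable {p q : ℝ} (hp : 0 ≤ p) (hq : 0 ≤ q)
include hp hq

/-- The factors in `drill` are chosen to add `p * c` and `q * c` to the squared lengths of the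
blocks, where `c` is the new squared third coordinate. Their difference is then `t * c`, as the
prism equation demands. -/
theorem blocks_drill {x : Fin 5 → ℝ} (hx : x ∈ puncturedPyramidSpace) :
    drill p q x 0 ^ 2 + drill p q x 1 ^ 2 =
        (1 - x 2 ^ 2) / 2 + p * (x 2 ^ 2 / (1 + p + q)) ∧
      drill p q x 3 ^ 2 + drill p q x 4 ^ 2 =
        (1 - x 2 ^ 2) / 2 + q * (x 2 ^ 2 / (1 + p + q)) ∧
      drill p q x 2 ^ 2 = x 2 ^ 2 / (1 + p + q) := by
  obtain ⟨ha, hb, hc⟩ := mem_puncturedPyramidSpace.1 hx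
  have h0 : 0 < (1 - x 2 ^ 2) / 2 := by linarith
  have hk : 0 < 1 + p + q := by positivity
  have hc' : 0 ≤ x 2 ^ 2 / (1 + p + q) := by positivity
  simp only [drill, blockScale, ha, hb]
  refine ⟨?_, ?_, ?_⟩
  · simp only [Matrix.cons_val, mul_pow, ← mul_add, ha]
    rw [Real.sq_sqrt (by positivity), div_mul_cancel₀ _ h0.ne']
  · simp only [Matrix.cons_val, mul_pow, ← mul_add, hb]
    rw [Real.sq_sqrt (by positivity), div_mul_cancel₀ _ h0.ne']
  · simp only [Matrix.cons_val, mul_pow, inv_pow, Real.sq_sqrt hk.le]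
    field_simp

theorem drill_mem {x : Fin 5 → ℝ} (hx : x ∈ puncturedPyramidSpace) :
    drill p q x ∈ drilledPrismSpace (p - q) := by
  obtain ⟨h₁, h₂, h₃⟩ := blocks_drill hp hq hx
  obtain ⟨ha, hb, hc⟩ := mem_puncturedPyramidSpace.1 hx
  have h0 : 0 < (1 - x 2 ^ 2) / 2 := by linarith
  have hk : 0 < 1 + p + q := by positivity
  have hc' : 0 ≤ x 2 ^ 2 / (1 + p + q) := by positivity
  have hc'' : x 2 ^ 2 / (1 + p + q) * (1 + p + q) = x 2 ^ 2 := by field_simp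
  rw [mem_drilledPrismSpace, h₁, h₂, prismSpace, mem_quadricIntersection_tuple]
  refine ⟨⟨?_, ?_⟩, by positivity, by positivity⟩
  · linear_combination (-1) * h₁ + h₂ + (p - q) * h₃
  · linear_combination h₁ + h₂ + h₃ + hc''

theorem undrill_drill {x : Fin 5 → ℝ} (hx : x ∈ puncturedPyramidSpace) :
    undrill p q (drill p q x) = x := by
  obtain ⟨h₁, h₂, h₃⟩ := blocks_drill hp hq hx
  obtain ⟨ha, hb, hc⟩ := mem_puncturedPyramidSpace.1 hx
  have h0 : 0 < (1 - x 2 ^ 2) / 2 := by linarith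
  have hk : 0 < 1 + p + q := by positivity
  have hc' : 0 ≤ x 2 ^ 2 / (1 + p + q) := by positivity
  have hc'' : (1 + p + q) * (x 2 ^ 2 / (1 + p + q)) = x 2 ^ 2 := by field_simp
  rw [undrill, h₁, h₂, h₃, hc'', drill, ha, hb]
  refine blockScale_blockScale x ?_ ?_ (mul_inv_cancel₀ (Real.sqrt_pos.2 hk).ne')
  · rw [← Real.sqrt_mul (by positivity), Real.sqrt_eq_one, div_mul_div_cancel₀ (by positivity),
      div_self h0.ne']
  · rw [← Real.sqrt_mul (by positivity), Real.sqrt_eq_one, div_mul_div_cancel₀ (by positivity),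
      div_self h0.ne']

variable (hpq : p * q = 0)
include hpq

/-- Since `p` or `q` is zero, `(1 - (1 + p + q) * y 2 ^ 2) / 2` is the squared length of the shorter
block, which is positive off the edge. It is the common squared length of both blocks after
`undrill`. -/
theorem blocks_of_mem_drilledPrismSpace {y : Fin 5 → ℝ} (hy : y ∈ drilledPrismSpace (p - q)) :
    0 < (1 - (1 + p + q) * y 2 ^ 2) / 2 ∧
      y 0 ^ 2 + y 1 ^ 2 = (1 - (1 + p + q) * y 2 ^ 2) / 2 + p * y 2 ^ 2 ∧
      y 3 ^ 2 + y 4 ^ 2 = (1 - (1 + p + q) * y 2 ^ 2) / 2 + q * y 2 ^ 2 := by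
  rw [mem_drilledPrismSpace, prismSpace, mem_quadricIntersection_tuple] at hy
  obtain ⟨⟨h₁, h₂⟩, ha, hb⟩ := hy
  refine ⟨?_, by linarith, by linarith⟩
  rcases mul_eq_zero.1 hpq with rfl | rfl <;> linarith

theorem blocks_undrill {y : Fin 5 → ℝ} (hy : y ∈ drilledPrismSpace (p - q)) :
    undrill p q y 0 ^ 2 + undrill p q y 1 ^ 2 = (1 - (1 + p + q) * y 2 ^ 2) / 2 ∧
      undrill p q y 3 ^ 2 + undrill p q y 4 ^ 2 = (1 - (1 + p + q) * y 2 ^ 2) / 2 ∧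
      undrill p q y 2 ^ 2 = (1 + p + q) * y 2 ^ 2 := by
  obtain ⟨hm, -, -⟩ := blocks_of_mem_drilledPrismSpace hp hq hpq hy
  obtain ⟨-, ha, hb⟩ := mem_drilledPrismSpace.1 hy
  have hk : 0 < 1 + p + q := by positivity
  simp only [undrill, blockScale]
  refine ⟨?_, ?_, ?_⟩
  · simp only [Matrix.cons_val, mul_pow, ← mul_add]
    rw [Real.sq_sqrt (by positivity), div_mul_cancel₀ _ ha.ne']
  · simp only [Matrix.cons_val, mul_pow, ← mul_add]
    rw [Real.sq_sqrt (by positivity), div_mul_cancel₀ _ hb.ne']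
  · simp only [Matrix.cons_val, mul_pow, Real.sq_sqrt hk.le]

theorem undrill_mem {y : Fin 5 → ℝ} (hy : y ∈ drilledPrismSpace (p - q)) :
    undrill p q y ∈ puncturedPyramidSpace := by
  obtain ⟨h₁, h₂, h₃⟩ := blocks_undrill hp hq hpq hy
  obtain ⟨hm, -, -⟩ := blocks_of_mem_drilledPrismSpace hp hq hpq hy
  rw [mem_puncturedPyramidSpace, h₁, h₂, h₃]
  exact ⟨rfl, rfl, by linarith⟩

theorem drill_undrill {y : Fin 5 → ℝ} (hy : y ∈ drilledPrismSpace (p - q)) :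
    drill p q (undrill p q y) = y := by
  obtain ⟨h₁, h₂, h₃⟩ := blocks_undrill hp hq hpq hy
  obtain ⟨hm, ha', hb'⟩ := blocks_of_mem_drilledPrismSpace hp hq hpq hy
  obtain ⟨-, ha, hb⟩ := mem_drilledPrismSpace.1 hy
  have hk : 0 < 1 + p + q := by positivity
  have hc : (1 + p + q) * y 2 ^ 2 / (1 + p + q) = y 2 ^ 2 := by field_simp
  rw [drill, h₁, h₂, h₃, hc, ← ha', ← hb', undrill]
  refine blockScale_blockScale y ?_ ?_ (inv_mul_cancel₀ (Real.sqrt_pos.2 hk).ne')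
  · rw [← Real.sqrt_mul (by positivity), Real.sqrt_eq_one, div_mul_div_cancel₀ (by positivity),
      div_self ha.ne']
  · rw [← Real.sqrt_mul (by positivity), Real.sqrt_eq_one, div_mul_div_cancel₀ (by positivity),
      div_self hb.ne']

/-- The punctured pyramid space is homeomorphic to the drilled prism space for `t = p - q`. -/
def drillHomeomorph : puncturedPyramidSpace ≃ₜ drilledPrismSpace (p - q) where
  toFun x := ⟨drill p q x, drill_mem hp hq x.2⟩
  invFun y := ⟨undrill p q y, undrill_mem hp hq hpq y.2⟩
  left_inv x := Subtype.ext (undrill_drill hp hq x.2)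
  right_inv y := Subtype.ext (drill_undrill hp hq hpq y.2)
  continuous_toFun := by
    have h := fun x : puncturedPyramidSpace => mem_puncturedPyramidSpace.1 x.2
    refine Continuous.subtype_mk (continuous_blockScale (Continuous.sqrt (Continuous.div
      (by fun_prop) (by fun_prop) fun x => ?_)) (Continuous.sqrt (Continuous.div
      (by fun_prop) (by fun_prop) fun x => ?_)) continuous_const continuous_subtype_val) _
    · rw [(h x).1]
      linarith [(h x).2.2]
    · rw [(h x).2.1]
      linarith [(h x).2.2]
  continuous_invFun := by
    have h := fun x : drilledPrismSpace (p - q) => mem_drilledPrismSpace.1 x.2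
    exact Continuous.subtype_mk (continuous_blockScale (Continuous.sqrt (Continuous.div
      (by fun_prop) (by fun_prop) fun x => (h x).2.1.ne')) (Continuous.sqrt (Continuous.div
      (by fun_prop) (by fun_prop) fun x => (h x).2.2.ne')) continuous_const
      continuous_subtype_val) _

end Drill

/-- The scaling factors are positive and depend on squares of coordinates only, hence signs are kept
and reflections commute with the map. -/
theorem exists_homeomorph_drilledPrismSpace (t : ℝ) :
    ∃ f : puncturedPyramidSpace ≃ₜ drilledPrismSpace t,
      (∀ x i, SignType.sign ((f x : Fin 5 → ℝ) i) = SignType.sign ((x : Fin 5 → ℝ) i)) ∧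
      ∀ (ε : Fin 5 → ℤˣ) (x y : puncturedPyramidSpace), (y : Fin 5 → ℝ) = reflect ε x →
        (f y : Fin 5 → ℝ) = reflect ε (f x) := by
  -- The positive and negative parts of `t`, so that one formula serves both smoothings.
  obtain ⟨p, q, hp, hq, hpq, rfl⟩ : ∃ p q : ℝ, 0 ≤ p ∧ 0 ≤ q ∧ p * q = 0 ∧ p - q = t := by
    rcases le_total 0 t with h | h
    · exact ⟨t, 0, h, le_rfl, by simp, by simp⟩
    · exact ⟨0, -t, le_rfl, by linarith, by simp, by simp⟩
  refine ⟨drillHomeomorph hp hq hpq, fun x i => ?_, fun ε x y h => ?_⟩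
  · obtain ⟨ha, hb, hc⟩ := mem_puncturedPyramidSpace.1 x.2
    have h0 : 0 < (1 - (x : Fin 5 → ℝ) 2 ^ 2) / 2 := by linarith
    refine sign_blockScale ?_ ?_ ?_ _ _
    · rw [ha]; positivity
    · rw [hb]; positivity
    · positivity
  · change drill p q y = reflect ε (drill p q x)
    rw [h, drill]
    simp only [reflect_sq]
    rw [blockScale_reflect]
    rfl

/-! ### Torus coordinates and the suspension -/

/-- The direction of a nonzero vector of the plane. -/
def direction (a b : ℝ) (h : 0 < a ^ 2 + b ^ 2) : Circle :=
  ⟨⟨a / √(a ^ 2 + b ^ 2), b / √(a ^ 2 + b ^ 2)⟩, by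
    change _ ∈ Metric.sphere (0 : ℂ) 1
    rw [mem_sphere_zero_iff_norm, Complex.norm_eq_sqrt_sq_add_sq, Real.sqrt_eq_one, div_pow,
      div_pow, Real.sq_sqrt h.le, ← add_div, div_self h.ne']⟩

theorem continuous_direction {X : Type*} [TopologicalSpace X] {f g : X → ℝ} (hf : Continuous f)
    (hg : Continuous g) (h : ∀ x, 0 < f x ^ 2 + g x ^ 2) :
    Continuous fun x => direction (f x) (g x) (h x) := by
  have hs : ∀ x, √(f x ^ 2 + g x ^ 2) ≠ 0 := fun x => (Real.sqrt_pos.2 (h x)).ne'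
  have : Continuous fun x => Complex.equivRealProdCLM.symm
      (f x / √(f x ^ 2 + g x ^ 2), g x / √(f x ^ 2 + g x ^ 2)) :=
    Complex.equivRealProdCLM.symm.continuous.comp
      ((hf.div (by fun_prop) hs).prodMk (hg.div (by fun_prop) hs))
  exact Continuous.subtype_mk (this.congr fun x => by apply Complex.ext <;> simp) _

theorem re_sq_add_im_sq (z : Circle) : (z : ℂ).re ^ 2 + (z : ℂ).im ^ 2 = 1 := by
  have := Circle.normSq_coe z
  rw [Complex.normSq_apply] at this
  linarith

theorem mul_re_sq_add_mul_im_sq (ρ : ℝ) (z : Circle) :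
    (ρ * (z : ℂ).re) ^ 2 + (ρ * (z : ℂ).im) ^ 2 = ρ ^ 2 := by
  linear_combination ρ ^ 2 * re_sq_add_im_sq z

theorem direction_mul {ρ : ℝ} (hρ : 0 < ρ) (z : Circle)
    (h : 0 < (ρ * (z : ℂ).re) ^ 2 + (ρ * (z : ℂ).im) ^ 2) :
    direction (ρ * (z : ℂ).re) (ρ * (z : ℂ).im) h = z := by
  apply Circle.ext
  apply Complex.ext
  · change ρ * (z : ℂ).re / √((ρ * (z : ℂ).re) ^ 2 + (ρ * (z : ℂ).im) ^ 2) = _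
    rw [mul_re_sq_add_mul_im_sq, Real.sqrt_sq hρ.le, mul_div_cancel_left₀ _ hρ.ne']
  · change ρ * (z : ℂ).im / √((ρ * (z : ℂ).re) ^ 2 + (ρ * (z : ℂ).im) ^ 2) = _
    rw [mul_re_sq_add_mul_im_sq, Real.sqrt_sq hρ.le, mul_div_cancel_left₀ _ hρ.ne']

theorem sqrt_mul_direction_re {a b r : ℝ} (h : 0 < a ^ 2 + b ^ 2) (hr : a ^ 2 + b ^ 2 = r) :
    √r * (direction a b h : ℂ).re = a := by
  subst hr
  exact mul_div_cancel₀ _ (Real.sqrt_pos.2 h).ne'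

theorem sqrt_mul_direction_im {a b r : ℝ} (h : 0 < a ^ 2 + b ^ 2) (hr : a ^ 2 + b ^ 2 = r) :
    √r * (direction a b h : ℂ).im = b := by
  subst hr
  exact mul_div_cancel₀ _ (Real.sqrt_pos.2 h).ne'

@[fun_prop]
theorem continuous_circle_re : Continuous fun z : Circle => (z : ℂ).re :=
  Complex.continuous_re.comp continuous_subtype_val

@[fun_prop]
theorem continuous_circle_im : Continuous fun z : Circle => (z : ℂ).im :=
  Complex.continuous_im.comp continuous_subtype_val

/-- The point of the pyramid space with third coordinate `s` and directions `z`, `w`. -/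
def torusPoint (z w : Circle) (s : ℝ) : Fin 5 → ℝ :=
  ![√((1 - s ^ 2) / 2) * (z : ℂ).re, √((1 - s ^ 2) / 2) * (z : ℂ).im, s,
    √((1 - s ^ 2) / 2) * (w : ℂ).re, √((1 - s ^ 2) / 2) * (w : ℂ).im]

theorem continuous_torusPoint {X : Type*} [TopologicalSpace X] {z w : X → Circle} {s : X → ℝ}
    (hz : Continuous z) (hw : Continuous w) (hs : Continuous s) :
    Continuous fun x => torusPoint (z x) (w x) (s x) := by
  refine continuous_pi fun i => ?_
  fin_cases i <;> simp [torusPoint] <;> fun_prop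

theorem torusPoint_mem {z w : Circle} {s : ℝ} (hs : s ∈ Icc (-1 : ℝ) 1) :
    torusPoint z w s ∈ pyramidSpace := by
  have h : 0 ≤ (1 - s ^ 2) / 2 := by nlinarith [hs.1, hs.2]
  rw [mem_pyramidSpace]
  simp only [torusPoint, Matrix.cons_val, mul_re_sq_add_mul_im_sq, Real.sq_sqrt h, and_self]

theorem torusPoint_mem_punctured {z w : Circle} {s : ℝ} (hs : s ∈ Ioo (-1 : ℝ) 1) :
    torusPoint z w s ∈ puncturedPyramidSpace := by
  have h := mem_pyramidSpace.1 (torusPoint_mem (z := z) (w := w) (Ioo_subset_Icc_self hs))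
  exact mem_puncturedPyramidSpace.2 ⟨h.1, h.2, (sq_lt_one_iff_abs_lt_one _).2 (abs_lt.2 hs)⟩

theorem torusPoint_direction {x : Fin 5 → ℝ} (hx : x ∈ puncturedPyramidSpace)
    (h : 0 < x 0 ^ 2 + x 1 ^ 2) (h' : 0 < x 3 ^ 2 + x 4 ^ 2) :
    torusPoint (direction (x 0) (x 1) h) (direction (x 3) (x 4) h') (x 2) = x := by
  obtain ⟨ha, hb, hc⟩ := mem_puncturedPyramidSpace.1 hx
  funext i
  fin_cases i
  exacts [sqrt_mul_direction_re h ha, sqrt_mul_direction_im h ha, rfl,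
    sqrt_mul_direction_re h' hb, sqrt_mul_direction_im h' hb]

theorem puncturedPyramidSpace_pos {x : Fin 5 → ℝ} (hx : x ∈ puncturedPyramidSpace) :
    0 < x 0 ^ 2 + x 1 ^ 2 ∧ 0 < x 3 ^ 2 + x 4 ^ 2 := by
  obtain ⟨ha, hb, hc⟩ := mem_puncturedPyramidSpace.1 hx
  constructor <;> linarith

/-- The punctured pyramid space is a product of a torus and an open interval. -/
def puncturedHomeomorph : puncturedPyramidSpace ≃ₜ Circle × Circle × Ioo (-1 : ℝ) 1 where
  toFun x := (direction _ _ (puncturedPyramidSpace_pos x.2).1,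
    direction _ _ (puncturedPyramidSpace_pos x.2).2, ⟨(x : Fin 5 → ℝ) 2,
      abs_lt.1 (sq_lt_one_iff_abs_lt_one _ |>.1 (mem_puncturedPyramidSpace.1 x.2).2.2)⟩)
  invFun p := ⟨torusPoint p.1 p.2.1 p.2.2, torusPoint_mem_punctured p.2.2.2⟩
  left_inv x := Subtype.ext (torusPoint_direction x.2 (puncturedPyramidSpace_pos x.2).1
    (puncturedPyramidSpace_pos x.2).2)
  right_inv p := by
    have h : 0 < √((1 - (p.2.2 : ℝ) ^ 2) / 2) := by
      have := (sq_lt_one_iff_abs_lt_one _).2 (abs_lt.2 p.2.2.2)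
      exact Real.sqrt_pos.2 (by linarith)
    exact Prod.ext (direction_mul h p.1 (by rw [mul_re_sq_add_mul_im_sq]; positivity))
      (Prod.ext (direction_mul h p.2.1 (by rw [mul_re_sq_add_mul_im_sq]; positivity)) rfl)
  continuous_toFun := by
    refine (continuous_direction (by fun_prop) (by fun_prop) _).prodMk
      ((continuous_direction (by fun_prop) (by fun_prop) _).prodMk
        (Continuous.subtype_mk (by fun_prop) _))
  continuous_invFun := Continuous.subtype_mk
    (continuous_torusPoint (by fun_prop) (by fun_prop) (by fun_prop))
    fun p => torusPoint_mem_punctured p.2.2.2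

/-- The map from the suspension of the torus to the pyramid space. -/
def suspensionMap : Suspension (Circle × Circle) → pyramidSpace :=
  Quotient.lift (fun p => ⟨torusPoint p.1.1 p.1.2 p.2, torusPoint_mem p.2.2⟩) (by
    rintro ⟨⟨z, w⟩, s⟩ ⟨⟨z', w'⟩, s'⟩ (h | ⟨rfl, h⟩)
    · rw [h]
    · have h1 : (s : ℝ) ^ 2 = 1 := by
        change (s : ℝ) = -1 ∨ (s : ℝ) = 1 at h
        rcases h with h | h <;> simp [h]
      simp [torusPoint, h1])

theorem continuous_suspensionMap : Continuous suspensionMap :=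
  Continuous.quotient_lift (Continuous.subtype_mk
    (continuous_torusPoint (by fun_prop) (by fun_prop) (by fun_prop)) _) _

/-- The suspension parameter is the third coordinate. Where it is not `±1` the common radius is
nonzero and the two directions can be read off; at `±1` both sides have a single point. -/
theorem bijective_suspensionMap : Function.Bijective suspensionMap := by
  constructor
  · intro p q
    induction p using Quotient.inductionOn with | _ p
    induction q using Quotient.inductionOn with | _ q
    obtain ⟨⟨z, w⟩, s⟩ := p
    obtain ⟨⟨z', w'⟩, s'⟩ := q
    intro h
    have h' : torusPoint z w s = torusPoint z' w' s' := congrArg Subtype.val h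
    have hs : s = s' := Subtype.ext (by simpa [torusPoint] using congrFun h' 2)
    subst hs
    apply Quotient.sound
    by_cases h1 : (s : ℝ) = -1 ∨ (s : ℝ) = 1
    · exact Or.inr ⟨rfl, h1⟩
    · left
      have hpos : √((1 - (s : ℝ) ^ 2) / 2) ≠ 0 := by
        rw [not_or] at h1
        have := lt_of_le_of_ne s.2.1 (Ne.symm h1.1)
        have := lt_of_le_of_ne s.2.2 h1.2
        exact (Real.sqrt_pos.2 (by nlinarith)).ne'
      have e0 := congrFun h' 0
      have e1 := congrFun h' 1
      have e3 := congrFun h' 3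
      have e4 := congrFun h' 4
      simp only [torusPoint, Matrix.cons_val] at e0 e1 e3 e4
      have hz : z = z' := Circle.ext (Complex.ext (mul_left_cancel₀ hpos e0)
        (mul_left_cancel₀ hpos e1))
      have hw : w = w' := Circle.ext (Complex.ext (mul_left_cancel₀ hpos e3)
        (mul_left_cancel₀ hpos e4))
      rw [hz, hw]
  · intro x
    by_cases hx : (x : Fin 5 → ℝ) ∈ puncturedPyramidSpace
    · refine ⟨Quotient.mk _ ((_, _), ⟨(x : Fin 5 → ℝ) 2, ?_⟩), Subtype.ext
        (torusPoint_direction hx (puncturedPyramidSpace_pos hx).1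
          (puncturedPyramidSpace_pos hx).2)⟩
      exact abs_le.1 ((sq_lt_one_iff_abs_lt_one _).1 (mem_puncturedPyramidSpace.1 hx).2.2).le
    · have h2 : (x : Fin 5 → ℝ) ∈ pointsOver (tuple 0) {apex} := by
        by_contra h
        exact hx ⟨x.2, h⟩
      have h2' := (mem_pointsOver_apex.1 h2).2
      have hsq := funext_iff.1 h2.2
      -- Any pair of directions would do, as the radius is zero.
      refine ⟨Quotient.mk _ ((1, 1), ⟨(x : Fin 5 → ℝ) 2, ?_⟩), Subtype.ext ?_⟩
      · exact abs_le.1 ((sq_le_one_iff_abs_le_one _).1 h2'.le)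
      · funext i
        have := hsq i
        change torusPoint 1 1 ((x : Fin 5 → ℝ) 2) i = _
        fin_cases i <;> simp [torusPoint, h2', apex] at this ⊢ <;> simp [this]

theorem mk_mem_suspensionApices {X : Type*} [TopologicalSpace X] (p : X × Icc (-1 : ℝ) 1) :
    (Quotient.mk (suspensionSetoid X) p : Suspension X) ∈ suspensionApices X ↔
      (p.2 : ℝ) = -1 ∨ (p.2 : ℝ) = 1 := by
  constructor
  · rintro ⟨x, s, hs, h⟩
    rcases Quotient.exact h with rfl | ⟨-, h'⟩
    exacts [hs, h']
  · exact fun h => ⟨p.1, p.2, h, rfl⟩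

/-- A continuous bijection from a compact space to a Hausdorff space is a homeomorphism, so no
continuous inverse is needed at the apices. -/
theorem exists_homeomorph_suspension :
    ∃ h : pyramidSpace ≃ₜ Suspension (Circle × Circle), ∀ x,
      h x ∈ suspensionApices (Circle × Circle) ↔
        (x : Fin 5 → ℝ) ∈ pointsOver (tuple 0) {apex} := by
  let e : Suspension (Circle × Circle) ≃ₜ pyramidSpace :=
    Continuous.homeoOfEquivCompactToT2 (f := Equiv.ofBijective _ bijective_suspensionMap)
      continuous_suspensionMap
  refine ⟨e.symm, fun x => ?_⟩
  obtain ⟨p, rfl⟩ := e.surjective x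
  rw [e.symm_apply_apply, mem_pointsOver_apex, and_iff_right (e p).2]
  induction p using Quotient.inductionOn with | _ p
  change _ ↔ (p.2 : ℝ) ^ 2 = 1
  rw [mk_mem_suspensionApices]
  simp [or_comm]

/-! ### The symmetry `t ↦ -t` and the circles over the new edge -/

/-- The exchange of the coordinate blocks `(0, 1)` and `(3, 4)`. -/
def swapBlocks : (Fin 5 → ℝ) ≃ₜ (Fin 5 → ℝ) where
  toFun x := ![x 3, x 4, x 2, x 0, x 1]
  invFun x := ![x 3, x 4, x 2, x 0, x 1]
  left_inv x := by funext i; fin_cases i <;> rfl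
  right_inv x := by funext i; fin_cases i <;> rfl
  continuous_toFun := by
    refine continuous_pi fun i => ?_
    fin_cases i <;> exact continuous_apply _
  continuous_invFun := by
    refine continuous_pi fun i => ?_
    fin_cases i <;> exact continuous_apply _

theorem swapBlocks_mem_prismSpace {t : ℝ} {x : Fin 5 → ℝ} :
    x ∈ prismSpace t ↔ swapBlocks x ∈ prismSpace (-t) := by
  rw [prismSpace, prismSpace, mem_quadricIntersection_tuple, mem_quadricIntersection_tuple]
  change _ ↔ -x 3 ^ 2 - x 4 ^ 2 + -t * x 2 ^ 2 + x 0 ^ 2 + x 1 ^ 2 = 0 ∧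
    x 3 ^ 2 + x 4 ^ 2 + x 2 ^ 2 + x 0 ^ 2 + x 1 ^ 2 = 1
  constructor <;> rintro ⟨h, h'⟩ <;> constructor <;> linarith

theorem mem_pointsOver_newEdge {t : ℝ} {x : Fin 5 → ℝ} :
    x ∈ pointsOver (tuple t) (newEdge t) ↔
      x ∈ prismSpace t ∧ ((x 0 = 0 ∧ x 1 = 0) ∨ (x 3 = 0 ∧ x 4 = 0)) := by
  simp only [pointsOver, newEdge, mem_ofPred_eq, sq_eq_zero_iff, prism, prismSpace]
  refine and_congr_right fun hx => and_iff_right ?_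
  rw [mem_quadricIntersection_tuple] at hx
  exact mem_polytope_tuple.2 ⟨fun i => sq_nonneg _, hx⟩

theorem swapBlocks_mem_pointsOver_newEdge {t : ℝ} {x : Fin 5 → ℝ} :
    x ∈ pointsOver (tuple t) (newEdge t) ↔
      swapBlocks x ∈ pointsOver (tuple (-t)) (newEdge (-t)) := by
  rw [mem_pointsOver_newEdge, mem_pointsOver_newEdge, ← swapBlocks_mem_prismSpace, or_comm]
  rfl

/-- The parametrization of the points over the new edge for `t > 0`. -/
def edgePoint (t : ℝ) (z : Circle) (i : Fin 2) : Fin 5 → ℝ :=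
  ![√(t / (1 + t)) * (z : ℂ).re, √(t / (1 + t)) * (z : ℂ).im, ![1, -1] i * (√(1 + t))⁻¹, 0, 0]

theorem edgePoint_mem {t : ℝ} (ht : 0 < t) (z : Circle) (i : Fin 2) :
    edgePoint t z i ∈ pointsOver (tuple t) (newEdge t) := by
  rw [mem_pointsOver_newEdge, prismSpace, mem_quadricIntersection_tuple]
  have h1 : 0 < 1 + t := by positivity
  have h2 : (![1, -1] i * (√(1 + t))⁻¹) ^ 2 = 1 / (1 + t) := by
    rw [mul_pow, inv_pow, Real.sq_sqrt h1.le]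
    fin_cases i <;> simp
  have h3 := mul_re_sq_add_mul_im_sq √(t / (1 + t)) z
  rw [Real.sq_sqrt (by positivity)] at h3
  refine ⟨⟨?_, ?_⟩, Or.inr ⟨rfl, rfl⟩⟩
  · simp only [edgePoint, Matrix.cons_val, h2]
    linear_combination -h3
  · simp only [edgePoint, Matrix.cons_val, h2]
    have : t / (1 + t) + 1 / (1 + t) = 1 := by field_simp; ring
    linear_combination h3 + this

/-- Over the edge the equations reduce to `x 2 ^ 2 = 1 / (1 + t)` and `x 0 ^ 2 + x 1 ^ 2 = t / (1 +
t)`; the sign of `x 2` separates the two circles. -/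
theorem nonempty_homeomorph_circles_of_pos {t : ℝ} (ht : 0 < t) :
    Nonempty (pointsOver (tuple t) (newEdge t) ≃ₜ Circle × Fin 2) := by
  let f : Circle × Fin 2 → pointsOver (tuple t) (newEdge t) :=
    fun p => ⟨edgePoint t p.1 p.2, edgePoint_mem ht _ _⟩
  have h1 : 0 < 1 + t := by positivity
  have hρ : 0 < √(t / (1 + t)) := Real.sqrt_pos.2 (by positivity)
  have hκ : 0 < √(1 + t) := Real.sqrt_pos.2 h1
  have hf : Continuous f := by
    refine Continuous.subtype_mk (continuous_pi fun i => ?_) _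
    have : Continuous fun p : Circle × Fin 2 => (![1, -1] p.2 : ℝ) :=
      (continuous_of_discreteTopology (f := fun i : Fin 2 => (![1, -1] i : ℝ))).comp continuous_snd
    fin_cases i
    · exact continuous_const.mul (continuous_circle_re.comp continuous_fst)
    · exact continuous_const.mul (continuous_circle_im.comp continuous_fst)
    · exact this.mul continuous_const
    · exact continuous_const
    · exact continuous_const
  have hinj : Function.Injective f := by
    rintro ⟨z, i⟩ ⟨w, j⟩ h
    have h' : edgePoint t z i = edgePoint t w j := congrArg Subtype.val h
    refine Prod.ext (Circle.ext (Complex.ext (mul_left_cancel₀ hρ.ne' (congrFun h' 0))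
      (mul_left_cancel₀ hρ.ne' (congrFun h' 1)))) ?_
    have h2 : (![1, -1] i : ℝ) = ![1, -1] j := mul_right_cancel₀ (inv_ne_zero hκ.ne') (congrFun h' 2)
    change i = j
    fin_cases i <;> fin_cases j <;> first | rfl | norm_num at h2
  have hsurj : Function.Surjective f := by
    rintro ⟨x, hx⟩
    obtain ⟨hx', h⟩ := mem_pointsOver_newEdge.1 hx
    rw [prismSpace, mem_quadricIntersection_tuple] at hx'
    obtain ⟨ha, hb⟩ := hx'
    have h34 : x 3 = 0 ∧ x 4 = 0 := by
      rcases h with ⟨h0, h1⟩ | h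
      · exfalso
        simp only [h0, h1] at ha hb
        have := mul_nonneg ht.le (sq_nonneg (x 2))
        have h2 : t * x 2 ^ 2 = 0 := by linarith [sq_nonneg (x 3), sq_nonneg (x 4)]
        have h2' := (mul_eq_zero.1 h2).resolve_left ht.ne'
        linarith
      · exact h
    obtain ⟨h3, h4⟩ := h34
    simp only [h3, h4] at ha hb
    have h2 : x 2 ^ 2 = (1 + t)⁻¹ := by
      refine eq_inv_of_mul_eq_one_left ?_
      linarith
    have h01 : x 0 ^ 2 + x 1 ^ 2 = t / (1 + t) := by
      rw [div_eq_mul_inv, ← h2]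
      linarith
    have hpos : 0 < x 0 ^ 2 + x 1 ^ 2 := by rw [h01]; positivity
    have h2' : ∃ i : Fin 2, (![1, -1] i : ℝ) * (√(1 + t))⁻¹ = x 2 := by
      rw [← Real.sq_sqrt h1.le, ← inv_pow] at h2
      rcases sq_eq_sq_iff_eq_or_eq_neg.1 h2 with h | h
      · exact ⟨0, by simp [h]⟩
      · exact ⟨1, by simp [h]⟩
    obtain ⟨i, hi⟩ := h2'
    refine ⟨(direction (x 0) (x 1) hpos, i), Subtype.ext (funext fun j => ?_)⟩
    fin_cases j
    exacts [sqrt_mul_direction_re hpos h01, sqrt_mul_direction_im hpos h01, hi, h3.symm, h4.symm]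
  exact ⟨(Continuous.homeoOfEquivCompactToT2 (f := Equiv.ofBijective f ⟨hinj, hsurj⟩) hf).symm⟩

theorem nonempty_homeomorph_circles {t : ℝ} (ht : t ≠ 0) :
    Nonempty (pointsOver (tuple t) (newEdge t) ≃ₜ Circle × Fin 2) := by
  rcases ht.lt_or_gt with h | h
  · obtain ⟨e⟩ := nonempty_homeomorph_circles_of_pos (neg_pos.2 h)
    exact ⟨(swapBlocks.subtype fun x => swapBlocks_mem_pointsOver_newEdge).trans e⟩
  · exact nonempty_homeomorph_circles_of_pos h

/-! ### The prism space as a product of a sphere and a circle -/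

/-- The point of the prism space, for `t > 0`, given by a point of the sphere and a direction. -/
def prismPoint (t : ℝ) (s : EuclideanSpace ℝ (Fin 3)) (z : Circle) : Fin 5 → ℝ :=
  ![√(t * (s 0 ^ 2 / (1 + t)) + (s 1 ^ 2 + s 2 ^ 2) / 2) * (z : ℂ).re,
    √(t * (s 0 ^ 2 / (1 + t)) + (s 1 ^ 2 + s 2 ^ 2) / 2) * (z : ℂ).im,
    s 0 / √(1 + t), s 1 / √2, s 2 / √2]

/-- The point of the sphere under a point of the prism space. -/
def spherePoint (t : ℝ) (x : Fin 5 → ℝ) : EuclideanSpace ℝ (Fin 3) :=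
  !₂[√(1 + t) * x 2, √2 * x 3, √2 * x 4]

section Prism

variable {t : ℝ} (ht : 0 < t)
include ht

/-- Adding the two equations eliminates the first block and leaves the ellipsoid `(1 + t) * x 2 ^ 2
+ 2 * x 3 ^ 2 + 2 * x 4 ^ 2 = 1`. -/
theorem spherePoint_mem {x : Fin 5 → ℝ} (hx : x ∈ prismSpace t) :
    spherePoint t x ∈ Metric.sphere (0 : EuclideanSpace ℝ (Fin 3)) 1 := by
  rw [prismSpace, mem_quadricIntersection_tuple] at hx
  rw [mem_sphere_zero_iff_norm, EuclideanSpace.norm_eq, Real.sqrt_eq_one, Fin.sum_univ_three]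
  simp only [spherePoint, Real.norm_eq_abs, sq_abs, PiLp.toLp_apply, Matrix.cons_val, mul_pow]
  rw [Real.sq_sqrt (by positivity), Real.sq_sqrt (by positivity)]
  linarith [hx.1, hx.2]

theorem prismSpace_pos {x : Fin 5 → ℝ} (hx : x ∈ prismSpace t) : 0 < x 0 ^ 2 + x 1 ^ 2 := by
  rw [prismSpace, mem_quadricIntersection_tuple] at hx
  obtain ⟨ha, hb⟩ := hx
  by_contra! h
  have h2 : t * x 2 ^ 2 ≤ 0 := by linarith [sq_nonneg (x 3), sq_nonneg (x 4)]
  have h2' : x 2 ^ 2 ≤ 0 := nonpos_of_mul_nonpos_right h2 ht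
  have := mul_nonneg ht.le (sq_nonneg (x 2))
  linarith

theorem sphere_radius_pos {s : EuclideanSpace ℝ (Fin 3)}
    (hs : s ∈ Metric.sphere (0 : EuclideanSpace ℝ (Fin 3)) 1) :
    s 0 ^ 2 + s 1 ^ 2 + s 2 ^ 2 = 1 ∧
      0 < t * (s 0 ^ 2 / (1 + t)) + (s 1 ^ 2 + s 2 ^ 2) / 2 := by
  rw [mem_sphere_zero_iff_norm, EuclideanSpace.norm_eq, Real.sqrt_eq_one, Fin.sum_univ_three] at hs
  simp only [Real.norm_eq_abs, sq_abs] at hs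
  refine ⟨hs, ?_⟩
  have h0 : 0 ≤ s 1 ^ 2 + s 2 ^ 2 := by positivity
  rcases h0.eq_or_lt with h | h
  · have : s 0 ^ 2 = 1 := by linarith
    rw [this, ← h]
    positivity
  · positivity

theorem prismPoint_mem {s : EuclideanSpace ℝ (Fin 3)}
    (hs : s ∈ Metric.sphere (0 : EuclideanSpace ℝ (Fin 3)) 1) (z : Circle) :
    prismPoint t s z ∈ prismSpace t := by
  obtain ⟨h1, hpos⟩ := sphere_radius_pos ht hs
  have ha := mul_re_sq_add_mul_im_sq √(t * (s 0 ^ 2 / (1 + t)) + (s 1 ^ 2 + s 2 ^ 2) / 2) z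
  rw [Real.sq_sqrt hpos.le] at ha
  rw [prismSpace, mem_quadricIntersection_tuple]
  have h2 : (s 0 / √(1 + t)) ^ 2 = s 0 ^ 2 / (1 + t) := by
    rw [div_pow, Real.sq_sqrt (by positivity)]
  have h3 : ∀ i, (s i / √2) ^ 2 = s i ^ 2 / 2 := fun i => by
    rw [div_pow, Real.sq_sqrt (by positivity)]
  have h4 : t * (s 0 ^ 2 / (1 + t)) + s 0 ^ 2 / (1 + t) = s 0 ^ 2 := by field_simp; ring
  simp only [prismPoint, Matrix.cons_val, h2, h3]
  constructor
  · linear_combination -ha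
  · linear_combination ha + h4 + h1

/-- For `t > 0` the prism space is a product of a sphere and a circle. -/
def prismHomeomorph :
    prismSpace t ≃ₜ Metric.sphere (0 : EuclideanSpace ℝ (Fin 3)) 1 × Circle where
  toFun x := (⟨spherePoint t x, spherePoint_mem ht x.2⟩, direction _ _ (prismSpace_pos ht x.2))
  invFun p := ⟨prismPoint t p.1 p.2, prismPoint_mem ht p.1.2 p.2⟩
  left_inv x := by
    have h1 : 0 < 1 + t := by positivity
    have hpos := prismSpace_pos ht x.2
    obtain ⟨x, hx⟩ := x
    have hx' := hx
    rw [prismSpace, mem_quadricIntersection_tuple] at hx'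
    have hr : x 0 ^ 2 + x 1 ^ 2 = t * ((√(1 + t) * x 2) ^ 2 / (1 + t)) +
        ((√2 * x 3) ^ 2 + (√2 * x 4) ^ 2) / 2 := by
      rw [mul_pow, mul_pow, mul_pow, Real.sq_sqrt h1.le, Real.sq_sqrt (by positivity),
        mul_div_cancel_left₀ _ h1.ne']
      linarith [hx'.1]
    refine Subtype.ext (funext fun i => ?_)
    fin_cases i
    exacts [sqrt_mul_direction_re hpos hr, sqrt_mul_direction_im hpos hr,
      mul_div_cancel_left₀ _ (Real.sqrt_pos.2 h1).ne',
      mul_div_cancel_left₀ _ (Real.sqrt_pos.2 two_pos).ne',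
      mul_div_cancel_left₀ _ (Real.sqrt_pos.2 two_pos).ne']
  right_inv p := by
    have h1 : 0 < 1 + t := by positivity
    have hρ := Real.sqrt_pos.2 (sphere_radius_pos ht p.1.2).2
    refine Prod.ext (Subtype.ext (PiLp.ext fun i => ?_))
      (direction_mul hρ p.2 (by rw [mul_re_sq_add_mul_im_sq]; positivity))
    fin_cases i
    exacts [mul_div_cancel₀ _ (Real.sqrt_pos.2 h1).ne',
      mul_div_cancel₀ _ (Real.sqrt_pos.2 two_pos).ne',
      mul_div_cancel₀ _ (Real.sqrt_pos.2 two_pos).ne']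
  continuous_toFun := by
    refine Continuous.prodMk (Continuous.subtype_mk ?_ _)
      (continuous_direction (by fun_prop) (by fun_prop) _)
    refine (PiLp.continuous_toLp 2 _).comp (continuous_pi fun i => ?_)
    fin_cases i <;> simp <;> fun_prop
  continuous_invFun := by
    refine Continuous.subtype_mk (continuous_pi fun i => ?_) _
    fin_cases i <;> simp [prismPoint] <;> fun_prop

end Prism

theorem nonempty_homeomorph_prismSpace {t : ℝ} (ht : t ≠ 0) :
    Nonempty (prismSpace t ≃ₜ Metric.sphere (0 : EuclideanSpace ℝ (Fin 3)) 1 × Circle) := by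
  rcases ht.lt_or_gt with h | h
  · exact ⟨(swapBlocks.subtype fun x => swapBlocks_mem_prismSpace).trans
      (prismHomeomorph (neg_pos.2 h))⟩
  · exact ⟨prismHomeomorph h⟩

/-! ### Path connectedness and fundamental groups of the three spaces -/

theorem pathConnectedSpace_of_homeomorph {X Y : Type*} [TopologicalSpace X] [TopologicalSpace Y]
    [PathConnectedSpace Y] (e : X ≃ₜ Y) : PathConnectedSpace X :=
  e.symm.surjective.pathConnectedSpace e.symm.continuous

theorem pathConnectedSpace_prismSpace {t : ℝ} (ht : t ≠ 0) : PathConnectedSpace (prismSpace t) := by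
  obtain ⟨e⟩ := nonempty_homeomorph_prismSpace ht
  have := simplyConnectedSpace_sphere (F := EuclideanSpace ℝ (Fin 3)) (by simp)
  exact pathConnectedSpace_of_homeomorph e

theorem nonempty_fundamentalGroup_prismSpace {t : ℝ} (ht : t ≠ 0) (x : prismSpace t) :
    Nonempty (FundamentalGroup (prismSpace t) x ≃* Multiplicative ℤ) := by
  obtain ⟨e⟩ := nonempty_homeomorph_prismSpace ht
  obtain ⟨f⟩ := nonempty_fundamentalGroup_mulEquiv e.toHomotopyEquiv x
  obtain ⟨g⟩ := nonempty_fundamentalGroup_sphere_prod_circle (e x)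
  exact ⟨f.trans g⟩

instance : PathConnectedSpace puncturedPyramidSpace :=
  have : PathConnectedSpace (Ioo (-1 : ℝ) 1) :=
    isPathConnected_iff_pathConnectedSpace.1 ((convex_Ioo _ _).isPathConnected ⟨0, by simp⟩)
  pathConnectedSpace_of_homeomorph puncturedHomeomorph

theorem nonempty_fundamentalGroup_puncturedPyramidSpace (x : puncturedPyramidSpace) :
    Nonempty (FundamentalGroup puncturedPyramidSpace x ≃* Multiplicative (ℤ × ℤ)) := by
  obtain ⟨f⟩ := nonempty_fundamentalGroup_mulEquiv puncturedHomeomorph.toHomotopyEquiv x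
  obtain ⟨g⟩ := nonempty_fundamentalGroup_torus_prod_Ioo (puncturedHomeomorph x)
  exact ⟨f.trans g⟩

/-- For `t = 0` the homogeneous equation does not involve `x 2`, so its cone is invariant under
translation along the apex vector. Without `±apex` there remains the torus times an interval, which
is path connected. -/
instance : SimplyConnectedSpace pyramidSpace := by
  have hapex : apex ∈ pyramidSpace := by
    rw [mem_pyramidSpace]
    simp [apex]
  refine simplyConnectedSpace_of_cone (Q := fun x : Fin 5 → ℝ => ∑ i, x i ^ 2)
    (K := {x | -x 0 ^ 2 - x 1 ^ 2 + x 3 ^ 2 + x 4 ^ 2 = 0}) (e := apex) (by fun_prop)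
    (fun c x => by simp [mul_pow, Finset.mul_sum]) (fun x hx => ?_) (fun x => ?_)
    (fun c x hx => ?_) (fun c x hx => ?_) hapex ?_
  · obtain ⟨i, hi⟩ := Function.ne_iff.1 hx
    exact Finset.sum_pos' (fun _ _ => sq_nonneg _) ⟨i, Finset.mem_univ _, sq_pos_of_ne_zero hi⟩
  · rw [pyramidSpace, mem_quadricIntersection_tuple]
    simp [Fin.sum_univ_five]
  · change -(c * x 0) ^ 2 - (c * x 1) ^ 2 + (c * x 3) ^ 2 + (c * x 4) ^ 2 = 0
    change -x 0 ^ 2 - x 1 ^ 2 + x 3 ^ 2 + x 4 ^ 2 = 0 at hx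
    linear_combination c ^ 2 * hx
  · change -(x 0 + c * 0) ^ 2 - (x 1 + c * 0) ^ 2 + (x 3 + c * 0) ^ 2 + (x 4 + c * 0) ^ 2 = 0
    simpa using hx
  · have : {x | x ∈ pyramidSpace ∧ x ≠ apex ∧ x ≠ -apex} = puncturedPyramidSpace := by
      ext x
      rw [puncturedPyramidSpace, mem_sdiff, mem_pointsOver_apex, mem_ofPred_eq]
      refine and_congr_right fun hx => ?_
      rw [and_iff_right hx, ← not_or, not_iff_not]
      constructor
      · rintro (rfl | rfl) <;> simp [apex]
      · intro h
        have hover := (mem_pointsOver_apex.2 ⟨hx, h⟩).2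
        have hsq := funext_iff.1 hover
        have h0 := hsq 0
        have h1 := hsq 1
        have h3 := hsq 3
        have h4 := hsq 4
        simp [apex] at h0 h1 h3 h4
        rcases (sq_eq_one_iff (a := x 2)).1 h with h2 | h2
        · left
          funext i
          fin_cases i <;> simp [apex, h0, h1, h2, h3, h4]
        · right
          funext i
          fin_cases i <;> simp [apex, h0, h1, h2, h3, h4]
    rw [this]
    exact isPathConnected_iff_pathConnectedSpace.2 inferInstance

end SquarePyramid

end

theorem mainTheorem11 :
    -- the apex `V` is the only vertex of the pyramid on more than three facets
    {v ∈ SquarePyramid.pyramid.extremePoints ℝ | 3 < {i | v i = 0}.ncard} = {SquarePyramid.apex} ∧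
    -- the intersection is the space obtained from the polytope by reflections
    (∀ t : ℝ, ∃ g : SquarePyramid.quadricIntersection (SquarePyramid.tuple t) ≃ₜ
        SquarePyramid.reflections (SquarePyramid.polytope (SquarePyramid.tuple t)),
      ∀ x i, (g x : Fin 5 → ℝ) i = (x : Fin 5 → ℝ) i * |(x : Fin 5 → ℝ) i|) ∧
    -- `Z(P_{p4})` is the suspension of the torus, and the points over `V` are its apices
    (∃ h : SquarePyramid.pyramidSpace ≃ₜ SquarePyramid.Suspension (Circle × Circle),
      ∀ x, h x ∈ SquarePyramid.suspensionApices (Circle × Circle) ↔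
        (x : Fin 5 → ℝ) ∈
          SquarePyramid.pointsOver (SquarePyramid.tuple 0) {SquarePyramid.apex}) ∧
    -- the smooth part is `Z(P_{p4})` minus the points over `V`
    SquarePyramid.smoothPart (SquarePyramid.tuple 0) = SquarePyramid.puncturedPyramidSpace ∧
    -- the points over the edge `E` form two disjoint circles
    (∀ t : ℝ, t ≠ 0 →
      Nonempty (SquarePyramid.pointsOver (SquarePyramid.tuple t) (SquarePyramid.newEdge t) ≃ₜ
        Circle × Fin 2)) ∧
    -- the smooth part coincides with `Z(P'_{p4})` minus the circles coming from `E`, compatibly with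
    -- the reflections and the mirror copies of the polytopes
    (∀ t : ℝ, t ≠ 0 →
      ∃ f : SquarePyramid.puncturedPyramidSpace ≃ₜ SquarePyramid.drilledPrismSpace t,
        (∀ x i, SignType.sign ((f x : Fin 5 → ℝ) i) = SignType.sign ((x : Fin 5 → ℝ) i)) ∧
        (∀ (ε : Fin 5 → ℤˣ) (x y : SquarePyramid.puncturedPyramidSpace),
          (y : Fin 5 → ℝ) = SquarePyramid.reflect ε x →
            (f y : Fin 5 → ℝ) = SquarePyramid.reflect ε (f x))) ∧
    Nonempty (SquarePyramid.puncturedPyramidSpace ≃ₜ Circle × Circle × Set.Ioo (-1 : ℝ) 1) ∧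
    -- `π₁(Z(P_{p4})) = 1`
    (PathConnectedSpace SquarePyramid.pyramidSpace ∧
      ∀ x : SquarePyramid.pyramidSpace,
        Subsingleton (FundamentalGroup SquarePyramid.pyramidSpace x)) ∧
    -- `π₁(Z(P'_{p4})) = π₁(S² × S¹) = ℤ`
    (∀ t : ℝ, t ≠ 0 →
      PathConnectedSpace (SquarePyramid.prismSpace t) ∧
      ∀ x : SquarePyramid.prismSpace t,
        Nonempty (FundamentalGroup (SquarePyramid.prismSpace t) x ≃* Multiplicative ℤ)) ∧
    (∀ y : Metric.sphere (0 : EuclideanSpace ℝ (Fin 3)) 1 × Circle,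
      Nonempty (FundamentalGroup (Metric.sphere (0 : EuclideanSpace ℝ (Fin 3)) 1 × Circle) y ≃*
        Multiplicative ℤ)) ∧
    -- `π₁(Ž(P_{p4})) = ℤ²`
    (PathConnectedSpace SquarePyramid.puncturedPyramidSpace ∧
      ∀ x : SquarePyramid.puncturedPyramidSpace,
        Nonempty (FundamentalGroup SquarePyramid.puncturedPyramidSpace x ≃*
          Multiplicative (ℤ × ℤ))) := by
  open SquarePyramid in
  exact ⟨extremePoints_pyramid, exists_homeomorph_reflections, exists_homeomorph_suspension,
    smoothPart_tuple_zero, fun t ht => nonempty_homeomorph_circles ht,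
    fun t _ => exists_homeomorph_drilledPrismSpace t, ⟨puncturedHomeomorph⟩,
    ⟨inferInstance, fun x => inferInstance⟩,
    fun t ht => ⟨pathConnectedSpace_prismSpace ht, nonempty_fundamentalGroup_prismSpace ht⟩,
    nonempty_fundamentalGroup_sphere_prod_circle,
    ⟨inferInstance, nonempty_fundamentalGroup_puncturedPyramidSpace⟩⟩
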